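/- **Proposition.** Let $p\in[-1,1]$ and $q=\sqrt{1-p^2}$. For $n\ge 0$ let $\pi_{(n+1,n)}$ be the irreducible unitary representation of the symmetric group $\mathfrak S_{2n+1}$ with Young diagram $(n+1,n)$, realized in the Hilbert space in which the standard Young tableaux of shape $(n+1,n)$ form an orthonormal basis, by Young's orthogonal form: for a Coxeter transposition $\sigma_j=(j,j+1)$ and a tableau $t$, $$\sigma_j t=r^{-1}\,t+\sqrt{1-r^{-2}}\;\sigma_j(t),$$ where $r=c_{j+1}-c_j$ is the difference of the contents (column minus row) of the cells of $t$ that contain $j+1$ and $j$, and $\sigma_j(t)$ is the tableau $t$ with $j$ and $j+1$ interchanged (the second term vanishes if $\sigma_j(t)$ is not standard). Let $i_n:\pi_{(n+1,n)}\hookrightarrow\pi_{(n+2,n+1)}$ be the $\mathfrak S_{2n+1}$-equivariant isometric embedding $$i_n(t)=p\,t_{21}+q\,t_{12},$$ where $t_{21}$ (respectively $t_{12}$) is obtained from $t$ by putting $2n+2$ into the second row and $2n+3$ into the first row (respectively $2n+2$ into the first row and $2n+3$ into the second row). Let $\Pi_1$ be the leading component of the stationary Schur--Weyl representation with parameters $p,q$,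 that is, the unitary representation of the infinite symmetric group $\mathfrak S_{\mathbb N}=\bigcup_N\mathfrak S_N$ (finitely supported permutations) in the Hilbert-space inductive limit of the chain $$\pi_{(1)}\hookrightarrow\pi_{(2,1)}\hookrightarrow\pi_{(3,2)}\hookrightarrow\cdots$$ with respect to the embeddings $i_0,i_1,i_2,\dots$. For $N\ge1$ let $$L_N=N e-(s_1+\dots+s_N)\in\mathbb C[\mathfrak S_N]\subset\mathbb C[\mathfrak S_{\mathbb N}],\qquad s_k=(k,k+1),\quad N+1\equiv1,$$ be the periodic Coxeter Laplacian. Then, as $N\to\infty$, the operators $\frac1N\Pi_1(L_N)$ converge in the weak operator topology to the scalar operator $\phi(p)E$, where $E$ is the identity operator and $$\phi(p)=\frac{13}{12}+\frac86\,p^4-\frac76\,p^2-\frac{\sqrt3}{2}\,p\sqrt{1-p^2}.$$ -/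

import Mathlib

namespace SchurWeyl

/-!
# Two-row Young tableaux

Entries are numbered from `0`: the entry called `m + 1` in the usual numbering is `m` here, and the
first (second) row has index `0` (`1`).  A tableau is recorded by the word `row : ℕ → Fin 2` which
lists the rows of its entries; this is the same as a path in the Young graph.
-/

/-- The number of those entries among `0, …, m - 1` that the word `w` puts into row `r`. -/
def rowLen (w : ℕ → Fin 2) (r : Fin 2) (m : ℕ) : ℕ := Nat.count (fun i => w i = r) m

/-- `IsTableau a b w`: the word `w` describes a standard Young tableau of the two-row shape
`(a, b)`. The letters `w 0, …, w (a + b - 1)` are the rows of the `a + b` entries, and the remaining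
letters, which carry no information, are normalised to `0`. Standardness is the ballot condition:
after each step the first row is at least as long as the second one. -/
structure IsTableau (a b : ℕ) (w : ℕ → Fin 2) : Prop where
  pad : ∀ m, a + b ≤ m → w m = 0
  len_zero : rowLen w 0 (a + b) = a
  len_one : rowLen w 1 (a + b) = b
  ballot : ∀ m, m ≤ a + b → rowLen w 1 m ≤ rowLen w 0 m

/-- The set `𝒯(λ)` of standard Young tableaux of shape `λ = (a, b)`. -/
@[ext]
structure Tableau (a b : ℕ) where
  row : ℕ → Fin 2
  isTableau : IsTableau a b row

instance (a b : ℕ) : Finite (Tableau a b) := by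
  refine Finite.of_injective (β := Fin (a + b) → Fin 2) (fun t i => t.row i) ?_
  intro s t h
  apply Tableau.ext
  funext m
  by_cases hm : m < a + b
  · exact congrFun h ⟨m, hm⟩
  · rw [s.isTableau.pad m (not_lt.mp hm), t.isTableau.pad m (not_lt.mp hm)]

noncomputable instance (a b : ℕ) : Fintype (Tableau a b) := Fintype.ofFinite _

noncomputable instance (a b : ℕ) : DecidableEq (Tableau a b) := Classical.decEq _

/-- The content (column minus row) of the cell that contains the entry `m`: its column, counted
from `0`, is the number of smaller entries in the same row. -/
def content (w : ℕ → Fin 2) (m : ℕ) : ℤ := (rowLen w (w m) m : ℤ) - ((w m : ℕ) : ℤ)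

/-- The axial distance `c_{j+1} - c_j` between the entries `j` and `j + 1`. -/
def axialDist (w : ℕ → Fin 2) (j : ℕ) : ℤ := content w (j + 1) - content w j

/-- Interchange the entries `j` and `j + 1`. -/
def swapWord (w : ℕ → Fin 2) (j : ℕ) : ℕ → Fin 2 := fun i => w (Equiv.swap j (j + 1) i)

/-- The Hilbert space in which the standard Young tableaux of shape `(a, b)` are an orthonormal
basis. It carries the irreducible representation `π_{(a,b)}` of the symmetric group, in Young's
orthogonal form (`spechtRep` below). -/
abbrev Specht (a b : ℕ) : Type := EuclideanSpace ℂ (Tableau a b)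

open Classical in
/-- The coordinate of `f` at the word `w`; it is `0` if `w` is not a tableau. -/
noncomputable def extend {a b : ℕ} (f : Specht a b) (w : ℕ → Fin 2) : ℂ :=
  if h : IsTableau a b w then f ⟨w, h⟩ else 0

/-- `r⁻¹`, where `r` is the axial distance between `j` and `j + 1`. -/
noncomputable def diagCoeff (w : ℕ → Fin 2) (j : ℕ) : ℂ := (((axialDist w j : ℝ)⁻¹ : ℝ) : ℂ)

/-- `√(1 - r⁻²)`, where `r` is the axial distance between `j` and `j + 1`. -/
noncomputable def offCoeff (w : ℕ → Fin 2) (j : ℕ) : ℂ :=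
  ((Real.sqrt (1 - ((axialDist w j : ℝ)⁻¹) ^ 2) : ℝ) : ℂ)

theorem extend_of {a b : ℕ} (f : Specht a b) {w : ℕ → Fin 2} (h : IsTableau a b w) :
    extend f w = f ⟨w, h⟩ := by simp [extend, h]

theorem extend_add {a b : ℕ} (f g : Specht a b) (w : ℕ → Fin 2) :
    extend (f + g) w = extend f w + extend g w := by
  unfold extend
  split_ifs
  · rfl
  · simp

theorem extend_smul {a b : ℕ} (c : ℂ) (f : Specht a b) (w : ℕ → Fin 2) :
    extend (c • f) w = c * extend f w := by
  unfold extend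
  split_ifs
  · rfl
  · simp

/-- Young's orthogonal form of the Coxeter transposition `σ_j = (j, j + 1)`: in coordinates,
`(σ_j f)(t) = r⁻¹ f(t) + √(1 - r⁻²) f(σ_j t)`, with `r` the axial distance between `j` and `j + 1`
in `t`, where the second term is dropped if `σ_j t` is not standard. The action on basis vectors is
`youngOp_single` below. -/
noncomputable def youngLin (a b j : ℕ) : Specht a b →ₗ[ℂ] Specht a b where
  toFun f := WithLp.toLp 2 fun t =>
    diagCoeff t.row j * f t + offCoeff t.row j * extend f (swapWord t.row j)
  map_add' f g := by
    ext t
    simp only [extend_add, PiLp.add_apply]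
    ring
  map_smul' c f := by
    ext t
    simp only [extend_smul, PiLp.smul_apply, smul_eq_mul, RingHom.id_apply]
    ring

/-! ### The Coxeter relations for Young's orthogonal form -/

theorem rowLen_succ (w : ℕ → Fin 2) (r : Fin 2) (m : ℕ) :
    rowLen w r (m + 1) = rowLen w r m + if w m = r then 1 else 0 := Nat.count_succ _ _

theorem swapWord_apply_left (w : ℕ → Fin 2) (j : ℕ) : swapWord w j j = w (j + 1) := by
  simp [swapWord]

theorem swapWord_apply_right (w : ℕ → Fin 2) (j : ℕ) : swapWord w j (j + 1) = w j := by
  simp [swapWord]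

theorem swapWord_apply_of_ne (w : ℕ → Fin 2) {j i : ℕ} (h1 : i ≠ j) (h2 : i ≠ j + 1) :
    swapWord w j i = w i := by
  simp [swapWord, Equiv.swap_apply_of_ne_of_ne h1 h2]

theorem swapWord_swapWord (w : ℕ → Fin 2) (j : ℕ) : swapWord (swapWord w j) j = w := by
  funext i; simp [swapWord]

theorem swapWord_eq_self {w : ℕ → Fin 2} {j : ℕ} (h : w j = w (j + 1)) : swapWord w j = w := by
  funext i
  by_cases h1 : i = j
  · rw [h1, swapWord_apply_left, h]
  by_cases h2 : i = j + 1
  · rw [h2, swapWord_apply_right, h]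
  exact swapWord_apply_of_ne w h1 h2

theorem rowLen_congr {w v : ℕ → Fin 2} (r : Fin 2) (m : ℕ) (h : ∀ i < m, w i = v i) :
    rowLen w r m = rowLen v r m := by
  induction m with
  | zero => rfl
  | succ m ih =>
    rw [rowLen_succ, rowLen_succ, ih fun i hi => h i (by omega), h m (by omega)]

theorem rowLen_swapWord_le (w : ℕ → Fin 2) (r : Fin 2) {j m : ℕ} (h : m ≤ j) :
    rowLen (swapWord w j) r m = rowLen w r m :=
  rowLen_congr r m fun i hi => swapWord_apply_of_ne w (by omega) (by omega)

theorem rowLen_swapWord_ge (w : ℕ → Fin 2) (r : Fin 2) {j m : ℕ} (h : j + 2 ≤ m) :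
    rowLen (swapWord w j) r m = rowLen w r m := by
  induction m, h using Nat.le_induction with
  | base =>
    rw [rowLen_succ, rowLen_succ, rowLen_succ, rowLen_succ, swapWord_apply_left,
      swapWord_apply_right, rowLen_swapWord_le w r le_rfl]
    omega
  | succ m hm ih =>
    rw [rowLen_succ, rowLen_succ, ih, swapWord_apply_of_ne w (by omega) (by omega)]

/-- The length of the first row minus the length of the second row after `m` steps. -/
def height (w : ℕ → Fin 2) (m : ℕ) : ℤ := (rowLen w 0 m : ℤ) - (rowLen w 1 m : ℤ)

theorem height_succ_zero {w : ℕ → Fin 2} {m : ℕ} (h : w m = 0) :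
    height w (m + 1) = height w m + 1 := by
  simp only [height, rowLen_succ, h]; simp; ring

theorem height_succ_one {w : ℕ → Fin 2} {m : ℕ} (h : w m = 1) :
    height w (m + 1) = height w m - 1 := by
  simp only [height, rowLen_succ, h]; simp; ring

theorem axialDist_same {w : ℕ → Fin 2} {j : ℕ} (h : w j = w (j + 1)) : axialDist w j = 1 := by
  simp only [axialDist, content, rowLen_succ, ← h]; simp

theorem axialDist_one_zero {w : ℕ → Fin 2} {j : ℕ} (h : w j = 1) (h' : w (j + 1) = 0) :
    axialDist w j = height w j + 1 := by
  simp only [axialDist, content, rowLen_succ, h, h', height]; simp; ring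

theorem axialDist_zero_one {w : ℕ → Fin 2} {j : ℕ} (h : w j = 0) (h' : w (j + 1) = 1) :
    axialDist w j = -(height w j + 1) := by
  simp only [axialDist, content, rowLen_succ, h, h', height]; simp; ring

theorem fin2 (x : Fin 2) : x = 0 ∨ x = 1 := by omega

theorem height_swapWord_le (w : ℕ → Fin 2) {j m : ℕ} (h : m ≤ j) :
    height (swapWord w j) m = height w m := by
  simp only [height, rowLen_swapWord_le w _ h]

theorem height_swapWord_ge (w : ℕ → Fin 2) {j m : ℕ} (h : j + 2 ≤ m) :
    height (swapWord w j) m = height w m := by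
  simp only [height, rowLen_swapWord_ge w _ h]

theorem axialDist_eq (w : ℕ → Fin 2) (j : ℕ) :
    axialDist w j = if w j = w (j + 1) then 1 else if w j = 1 then height w j + 1
      else -(height w j + 1) := by
  split_ifs with h1 h2
  · exact axialDist_same h1
  · exact axialDist_one_zero h2 (by omega)
  · exact axialDist_zero_one (by omega) (by omega)

theorem axialDist_swapWord_self {w : ℕ → Fin 2} {j : ℕ} (h : w j ≠ w (j + 1)) :
    axialDist (swapWord w j) j = - axialDist w j := by
  rw [axialDist_eq, axialDist_eq, swapWord_apply_left, swapWord_apply_right,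
    height_swapWord_le w le_rfl, if_neg h, if_neg (Ne.symm h)]
  split_ifs <;> omega

theorem axialDist_swapWord_far (w : ℕ → Fin 2) {i j : ℕ} (h : i + 2 ≤ j ∨ j + 2 ≤ i) :
    axialDist (swapWord w j) i = axialDist w i := by
  rw [axialDist_eq, axialDist_eq, swapWord_apply_of_ne w (by omega) (by omega),
    swapWord_apply_of_ne w (i := i + 1) (by omega) (by omega)]
  rcases h with h | h
  · rw [height_swapWord_le w (by omega)]
  · rw [height_swapWord_ge w (by omega)]

theorem swapWord_comm (w : ℕ → Fin 2) {i j : ℕ} (h : i + 2 ≤ j ∨ j + 2 ≤ i) :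
    swapWord (swapWord w i) j = swapWord (swapWord w j) i := by
  funext m
  by_cases h1 : m = i
  · subst h1
    rw [swapWord_apply_of_ne _ (by omega) (by omega), swapWord_apply_left, swapWord_apply_left,
      swapWord_apply_of_ne _ (by omega) (by omega)]
  by_cases h2 : m = i + 1
  · subst h2
    rw [swapWord_apply_of_ne _ (by omega) (by omega), swapWord_apply_right, swapWord_apply_right,
      swapWord_apply_of_ne _ (by omega) (by omega)]
  rw [swapWord_apply_of_ne (swapWord w j) h1 h2]
  by_cases h3 : m = j
  · subst h3
    rw [swapWord_apply_left, swapWord_apply_left, swapWord_apply_of_ne _ (by omega) (by omega)]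
  by_cases h4 : m = j + 1
  · subst h4
    rw [swapWord_apply_right, swapWord_apply_right, swapWord_apply_of_ne _ (by omega) (by omega)]
  rw [swapWord_apply_of_ne _ h3 h4, swapWord_apply_of_ne _ h1 h2, swapWord_apply_of_ne _ h3 h4]

theorem IsTableau.height_nonneg {a b : ℕ} {w : ℕ → Fin 2} (h : IsTableau a b w) {m : ℕ}
    (hm : m ≤ a + b) : 0 ≤ height w m := by
  have := h.ballot m hm
  simp only [height]; omega

/-- If `√(1 - r⁻²)` is not zero, then interchanging `j` and `j + 1` keeps the tableau standard. -/
theorem IsTableau.swap {a b : ℕ} {w : ℕ → Fin 2} (h : IsTableau a b w) {j : ℕ}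
    (hj : j + 1 < a + b) (hc : offCoeff w j ≠ 0) : IsTableau a b (swapWord w j) := by
  by_cases hs : w j = w (j + 1)
  · rwa [swapWord_eq_self hs]
  refine ⟨fun m hm => ?_, ?_, ?_, fun m hm => ?_⟩
  · rw [swapWord_apply_of_ne w (by omega) (by omega)]; exact h.pad m hm
  · rw [rowLen_swapWord_ge w _ (by omega)]; exact h.len_zero
  · rw [rowLen_swapWord_ge w _ (by omega)]; exact h.len_one
  · rcases lt_trichotomy m (j + 1) with h1 | h1 | h1
    · rw [rowLen_swapWord_le w _ (by omega), rowLen_swapWord_le w _ (by omega)]; exact h.ballot m hm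
    · subst h1
      rw [rowLen_succ, rowLen_succ, rowLen_swapWord_le w _ le_rfl, rowLen_swapWord_le w _ le_rfl,
        swapWord_apply_left]
      have hb := h.ballot j (by omega)
      rcases fin2 (w (j + 1)) with h2 | h2
      · simp [h2]; omega
      · have h3 : w j = 0 := by omega
        simp only [h2]
        simp only [reduceIte, Fin.isValue, one_ne_zero, add_zero]
        by_contra hlt
        apply hc
        have h4 : height w j = 0 := by simp only [height]; omega
        have : axialDist w j = -1 := by rw [axialDist_zero_one h3 h2, h4]; rfl
        simp [offCoeff, this]
    · rw [rowLen_swapWord_ge w _ (by omega), rowLen_swapWord_ge w _ (by omega)]; exact h.ballot m hm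

/-- The formula of `youngLin` for functions on all words. -/
noncomputable def wordOp (j : ℕ) (F : (ℕ → Fin 2) → ℂ) (w : ℕ → Fin 2) : ℂ :=
  diagCoeff w j * F w + offCoeff w j * F (swapWord w j)

theorem youngLin_apply {a b j : ℕ} (f : Specht a b) (t : Tableau a b) :
    youngLin a b j f t = diagCoeff t.row j * f t + offCoeff t.row j * extend f (swapWord t.row j) := rfl

theorem extend_youngLin {a b j : ℕ} (hj : j + 1 < a + b) {f : Specht a b} {F : (ℕ → Fin 2) → ℂ}
    (hF : ∀ w, IsTableau a b w → extend f w = F w) (w : ℕ → Fin 2) (hw : IsTableau a b w) :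
    extend (youngLin a b j f) w = wordOp j F w := by
  rw [extend_of _ hw, youngLin_apply, wordOp, ← hF w hw, extend_of f hw]
  by_cases hc : offCoeff w j = 0
  · simp [hc]
  · rw [hF _ (hw.swap hj hc)]

theorem ext_of_extend {a b : ℕ} {f g : Specht a b}
    (h : ∀ w, IsTableau a b w → extend f w = extend g w) : f = g := by
  ext t
  have := h t.row t.isTableau
  rwa [extend_of _ t.isTableau, extend_of _ t.isTableau] at this

theorem coeff_sq {w : ℕ → Fin 2} {j : ℕ} (h : axialDist w j ≠ 0) :
    diagCoeff w j ^ 2 + offCoeff w j ^ 2 = 1 := by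
  rw [diagCoeff, offCoeff, ← Complex.ofReal_pow, ← Complex.ofReal_pow, Real.sq_sqrt]
  · push_cast; ring
  · have h1 : (1 : ℝ) ≤ |(axialDist w j : ℝ)| := by
      rw [← Int.cast_abs]; exact_mod_cast Int.one_le_abs h
    have : |(axialDist w j : ℝ)|⁻¹ ≤ 1 := inv_le_one_of_one_le₀ h1
    have h2 : (axialDist w j : ℝ)⁻¹ ^ 2 = |(axialDist w j : ℝ)|⁻¹ ^ 2 := by
      rw [inv_pow, inv_pow, sq_abs]
    rw [h2]
    have : 0 ≤ |(axialDist w j : ℝ)|⁻¹ := by positivity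
    nlinarith

theorem IsTableau.axialDist_ne_zero {a b : ℕ} {w : ℕ → Fin 2} (h : IsTableau a b w) {j : ℕ}
    (hj : j ≤ a + b) : axialDist w j ≠ 0 := by
  have := h.height_nonneg hj
  rw [axialDist_eq]; split_ifs <;> omega

theorem offCoeff_swap (w : ℕ → Fin 2) (j : ℕ) : offCoeff (swapWord w j) j = offCoeff w j := by
  by_cases h : w j = w (j + 1)
  · rw [swapWord_eq_self h]
  · simp [offCoeff, axialDist_swapWord_self h, inv_neg]

theorem diagCoeff_swap {w : ℕ → Fin 2} {j : ℕ} (h : w j ≠ w (j + 1)) :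
    diagCoeff (swapWord w j) j = - diagCoeff w j := by
  simp [diagCoeff, axialDist_swapWord_self h, inv_neg]

theorem offCoeff_same {w : ℕ → Fin 2} {j : ℕ} (h : w j = w (j + 1)) : offCoeff w j = 0 := by
  simp [offCoeff, axialDist_same h]

theorem diagCoeff_same {w : ℕ → Fin 2} {j : ℕ} (h : w j = w (j + 1)) : diagCoeff w j = 1 := by
  simp [diagCoeff, axialDist_same h]

theorem wordOp_sq {w : ℕ → Fin 2} {j : ℕ} (h : axialDist w j ≠ 0) (F : (ℕ → Fin 2) → ℂ) :
    wordOp j (wordOp j F) w = F w := by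
  by_cases hs : w j = w (j + 1)
  · simp [wordOp, offCoeff_same hs, diagCoeff_same hs]
  · simp only [wordOp, swapWord_swapWord, offCoeff_swap, diagCoeff_swap hs]
    linear_combination F w * coeff_sq h

theorem wordOp_comm {i j : ℕ} (h : i + 2 ≤ j ∨ j + 2 ≤ i) (F : (ℕ → Fin 2) → ℂ)
    (w : ℕ → Fin 2) : wordOp i (wordOp j F) w = wordOp j (wordOp i F) w := by
  simp only [wordOp, diagCoeff, offCoeff, axialDist_swapWord_far w h,
    axialDist_swapWord_far w h.symm, swapWord_comm w h]
  ring


theorem wordOp_braid_aux {j : ℕ} {u v x : ℕ → Fin 2} {α β c s : ℂ}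
    (h1 : swapWord u (j + 1) = v) (h2 : swapWord v j = x)
    (hu : u j = u (j + 1)) (hx : x (j + 1) = x (j + 1 + 1))
    (du : diagCoeff u (j + 1) = -β) (ou : offCoeff u (j + 1) = s)
    (dv : diagCoeff v j = -α) (ov : offCoeff v j = c)
    (dv' : diagCoeff v (j + 1) = β) (ov' : offCoeff v (j + 1) = s)
    (dx : diagCoeff x j = α) (ox : offCoeff x j = c)
    (hc : α ^ 2 + c ^ 2 = 1) (hs : β ^ 2 + s ^ 2 = 1) (hαβ : α - β = α * β)
    (F : (ℕ → Fin 2) → ℂ) (w : ℕ → Fin 2) (hw : w = u ∨ w = v ∨ w = x) :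
    wordOp j (wordOp (j + 1) (wordOp j F)) w
      = wordOp (j + 1) (wordOp j (wordOp (j + 1) F)) w := by
  have h3 : swapWord v (j + 1) = u := by rw [← h1, swapWord_swapWord]
  have h4 : swapWord x j = v := by rw [← h2, swapWord_swapWord]
  have h5 := swapWord_eq_self hu
  have h6 := swapWord_eq_self hx
  have h7 := diagCoeff_same hu
  have h8 := offCoeff_same hu
  have h9 := diagCoeff_same hx
  have h10 := offCoeff_same hx
  rcases hw with rfl | rfl | rfl
  · simp only [wordOp, h1, h2, h3, h5, h6, h7, h8, h9, h10, du, ou, dv, ov, dv', ov']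
    generalize F w = X
    generalize F v = Y
    generalize F x = Z
    grind
  · simp only [wordOp, h1, h2, h3, h4, h5, h6, h7, h8, h9, h10, du, ou, dv, ov, dv', ov', dx, ox]
    generalize F w = X
    generalize F u = Y
    generalize F x = Z
    grind
  · simp only [wordOp, h2, h3, h4, h5, h6, h7, h8, h9, h10, dv, ov, dv', ov', dx, ox]
    generalize F w = X
    generalize F u = Y
    generalize F v = Z
    grind

theorem diagCoeff_eq {w : ℕ → Fin 2} {j : ℕ} {r : ℤ} (h : axialDist w j = r) :
    diagCoeff w j = (r : ℂ)⁻¹ := by simp [diagCoeff, h]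

theorem wordOp_braid {a b : ℕ} {w : ℕ → Fin 2} (h : IsTableau a b w) {j : ℕ}
    (hj : j + 2 < a + b) (F : (ℕ → Fin 2) → ℂ) :
    wordOp j (wordOp (j + 1) (wordOp j F)) w
      = wordOp (j + 1) (wordOp j (wordOp (j + 1) F)) w := by
  have hd0 := h.height_nonneg (m := j) (by omega)
  have hd1 := h.height_nonneg (m := j + 1) (by omega)
  have hd2 := h.height_nonneg (m := j + 2) (by omega)
  have hd3 := h.height_nonneg (m := j + 3) (by omega)
  have key : ∀ (p : Fin 2) (u v x : ℕ → Fin 2), swapWord u (j + 1) = v → swapWord v j = x →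
      u j = p → u (j + 1) = p → u (j + 2) = 1 - p → height u j = height w j →
      (p = 1 → 1 ≤ height w j) → (w = u ∨ w = v ∨ w = x) →
      wordOp j (wordOp (j + 1) (wordOp j F)) w
        = wordOp (j + 1) (wordOp j (wordOp (j + 1) F)) w := by
    intro p u v x h1 h2 u0 u1 u2 hh hp hw
    have v0 : v j = p := by rw [← h1, swapWord_apply_of_ne _ (by omega) (by omega), u0]
    have v1 : v (j + 1) = 1 - p := by rw [← h1, swapWord_apply_left, u2]
    have v2 : v (j + 2) = p := by rw [← h1]; rw [swapWord_apply_right, u1]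
    have x0 : x j = 1 - p := by rw [← h2, swapWord_apply_left, v1]
    have x1 : x (j + 1) = p := by rw [← h2, swapWord_apply_right, v0]
    have x2 : x (j + 2) = p := by rw [← h2, swapWord_apply_of_ne _ (by omega) (by omega), v2]
    have hv : height v j = height w j := by rw [← h1, height_swapWord_le _ (by omega), hh]
    have hx : height x j = height w j := by rw [← h2, height_swapWord_le _ (by omega), hv]
    have ru : axialDist v (j + 1) = - axialDist u (j + 1) := by
      rw [← h1]
      apply axialDist_swapWord_self
      rw [u1, u2]
      omega
    have rx : axialDist x j = - axialDist v j := by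
      rw [← h2]
      apply axialDist_swapWord_self
      rw [v0, v1]
      omega
    have o1 : offCoeff v (j + 1) = offCoeff u (j + 1) := by rw [← h1, offCoeff_swap]
    have o2 : offCoeff x j = offCoeff v j := by rw [← h2, offCoeff_swap]
    set d := height w j with hd
    have hβ : axialDist v (j + 1) = if p = 0 then d + 2 else -d := by
      rcases fin2 p with rfl | rfl
      · rw [axialDist_one_zero v1 v2, height_succ_zero v0, hv]; simp; ring
      · rw [axialDist_zero_one v1 v2, height_succ_one v0, hv]; simp
    have hα : axialDist x j = if p = 0 then d + 1 else -(d + 1) := by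
      rcases fin2 p with rfl | rfl
      · rw [axialDist_one_zero x0 x1, hx]; simp
      · rw [axialDist_zero_one x0 x1, hx]; simp
    have nβ : axialDist v (j + 1) ≠ 0 := by
      rw [hβ]; split_ifs with hp0
      · omega
      · have := hp (by omega)
        omega
    have nα : axialDist x j ≠ 0 := by
      rw [hα]; split_ifs <;> omega
    refine wordOp_braid_aux (α := diagCoeff x j) (β := diagCoeff v (j + 1))
      (c := offCoeff x j) (s := offCoeff v (j + 1)) h1 h2 (by rw [u0, u1]) (by rw [x1, x2])
      ?_ o1.symm ?_ o2.symm rfl rfl rfl rfl (coeff_sq nα) (coeff_sq nβ) ?_ F w hw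
    · rw [diagCoeff_eq rfl, diagCoeff_eq rfl, ru]; push_cast; rw [inv_neg, neg_neg]
    · rw [diagCoeff_eq rfl, diagCoeff_eq rfl, rx]; push_cast; rw [inv_neg, neg_neg]
    · rw [diagCoeff_eq rfl, diagCoeff_eq rfl]
      have nα' : (axialDist x j : ℂ) ≠ 0 := by exact_mod_cast nα
      have nβ' : (axialDist v (j + 1) : ℂ) ≠ 0 := by exact_mod_cast nβ
      have e : axialDist v (j + 1) - axialDist x j = 1 := by
        rw [hα, hβ]; split_ifs <;> ring
      have e' : (axialDist v (j + 1) : ℂ) - (axialDist x j : ℂ) = 1 := by exact_mod_cast e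
      field_simp
      exact e'
  rcases fin2 (w j) with w0 | w0 <;> rcases fin2 (w (j + 1)) with w1 | w1 <;>
    rcases fin2 (w (j + 2)) with w2 | w2
  · have e1 : w j = w (j + 1) := by rw [w0, w1]
    have e2 : w (j + 1) = w (j + 1 + 1) := by rw [w1, ← w2]
    simp only [wordOp, swapWord_eq_self e1, swapWord_eq_self e2]
    simp only [diagCoeff_same e1, diagCoeff_same e2, offCoeff_same e1, offCoeff_same e2]
  · exact key 0 w _ _ rfl rfl w0 w1 (by rw [w2]; rfl) rfl (by simp) (Or.inl rfl)
  · exact key 0 (swapWord w (j + 1)) w _ (swapWord_swapWord _ _) rfl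
      (by rw [swapWord_apply_of_ne _ (by omega) (by omega), w0])
      (by rw [swapWord_apply_left]; exact w2) (by rw [swapWord_apply_right, w1]; rfl)
      (height_swapWord_le _ (by omega)) (by simp) (Or.inr (Or.inl rfl))
  · have g1 := height_succ_zero w0
    have g2 : height w (j + 2) = _ := height_succ_one w1
    have g3 : height w (j + 3) = _ := height_succ_one w2
    exact key 1 (swapWord (swapWord w j) (j + 1)) (swapWord w j) w (swapWord_swapWord _ _)
      (swapWord_swapWord _ _)
      (by rw [swapWord_apply_of_ne _ (by omega) (by omega), swapWord_apply_left, w1])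
      (by rw [swapWord_apply_left, swapWord_apply_of_ne _ (by omega) (by omega)]; exact w2)
      (by rw [swapWord_apply_right, swapWord_apply_right, w0]; rfl)
      (by rw [height_swapWord_le _ (by omega), height_swapWord_le _ (by omega)])
      (by intro; omega) (Or.inr (Or.inr rfl))
  · exact key 0 (swapWord (swapWord w j) (j + 1)) (swapWord w j) w (swapWord_swapWord _ _)
      (swapWord_swapWord _ _)
      (by rw [swapWord_apply_of_ne _ (by omega) (by omega), swapWord_apply_left, w1])
      (by rw [swapWord_apply_left, swapWord_apply_of_ne _ (by omega) (by omega)]; exact w2)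
      (by rw [swapWord_apply_right, swapWord_apply_right, w0]; rfl)
      (by rw [height_swapWord_le _ (by omega), height_swapWord_le _ (by omega)])
      (by simp) (Or.inr (Or.inr rfl))
  · have g1 := height_succ_one w0
    exact key 1 (swapWord w (j + 1)) w _ (swapWord_swapWord _ _) rfl
      (by rw [swapWord_apply_of_ne _ (by omega) (by omega), w0])
      (by rw [swapWord_apply_left]; exact w2) (by rw [swapWord_apply_right, w1]; rfl)
      (height_swapWord_le _ (by omega)) (by intro; omega) (Or.inr (Or.inl rfl))
  · have g1 := height_succ_one w0
    exact key 1 w _ _ rfl rfl w0 w1 (by rw [w2]; rfl) rfl (by intro; omega) (Or.inl rfl)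
  · have e1 : w j = w (j + 1) := by rw [w0, w1]
    have e2 : w (j + 1) = w (j + 1 + 1) := by rw [w1, ← w2]
    simp only [wordOp, swapWord_eq_self e1, swapWord_eq_self e2]
    simp only [diagCoeff_same e1, diagCoeff_same e2, offCoeff_same e1, offCoeff_same e2]

theorem youngLin_sq {a b j : ℕ} (hj : j + 1 < a + b) (f : Specht a b) :
    youngLin a b j (youngLin a b j f) = f := by
  apply ext_of_extend
  intro w hw
  rw [extend_youngLin hj (extend_youngLin hj fun _ _ => rfl) w hw,
    wordOp_sq (hw.axialDist_ne_zero (by omega))]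

theorem youngLin_comm {a b i j : ℕ} (hi : i + 1 < a + b) (hj : j + 1 < a + b)
    (h : i + 2 ≤ j ∨ j + 2 ≤ i) (f : Specht a b) :
    youngLin a b i (youngLin a b j f) = youngLin a b j (youngLin a b i f) := by
  apply ext_of_extend
  intro w hw
  rw [extend_youngLin hi (extend_youngLin hj fun _ _ => rfl) w hw,
    extend_youngLin hj (extend_youngLin hi fun _ _ => rfl) w hw, wordOp_comm h]

theorem youngLin_braid {a b j : ℕ} (hj : j + 2 < a + b) (f : Specht a b) :
    youngLin a b j (youngLin a b (j + 1) (youngLin a b j f))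
      = youngLin a b (j + 1) (youngLin a b j (youngLin a b (j + 1) f)) := by
  have h1 : j + 1 < a + b := by omega
  apply ext_of_extend
  intro w hw
  rw [extend_youngLin h1 (extend_youngLin hj (extend_youngLin h1 fun _ _ => rfl)) w hw,
    extend_youngLin hj (extend_youngLin h1 (extend_youngLin hj fun _ _ => rfl)) w hw,
    wordOp_braid hw hj]


/-! ### Unitarity -/

open Classical in
/-- `σ_j t` if it is standard, and `t` otherwise. -/
noncomputable def swapTab {a b : ℕ} (j : ℕ) (t : Tableau a b) : Tableau a b :=
  if h : IsTableau a b (swapWord t.row j) then ⟨swapWord t.row j, h⟩ else t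

theorem swapTab_of {a b j : ℕ} {t : Tableau a b} (h : IsTableau a b (swapWord t.row j)) :
    swapTab j t = ⟨swapWord t.row j, h⟩ := by simp [swapTab, h]

theorem swapTab_of_not {a b j : ℕ} {t : Tableau a b} (h : ¬ IsTableau a b (swapWord t.row j)) :
    swapTab j t = t := by simp [swapTab, h]

theorem swapTab_swapTab {a b : ℕ} (j : ℕ) (t : Tableau a b) : swapTab j (swapTab j t) = t := by
  by_cases h : IsTableau a b (swapWord t.row j)
  · have h2 : IsTableau a b (swapWord (swapTab j t).row j) := by
      rw [swapTab_of h]; simp only [swapWord_swapWord]; exact t.isTableau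
    rw [swapTab_of h2]
    apply Tableau.ext
    simp only [swapTab_of h, swapWord_swapWord]
  · rw [swapTab_of_not h, swapTab_of_not h]

theorem offCoeff_swapTab {a b : ℕ} (j : ℕ) (t : Tableau a b) :
    offCoeff (swapTab j t).row j = offCoeff t.row j := by
  by_cases h : IsTableau a b (swapWord t.row j)
  · rw [swapTab_of h]; exact offCoeff_swap _ _
  · rw [swapTab_of_not h]

theorem youngLin_apply' {a b j : ℕ} (hj : j + 1 < a + b) (f : Specht a b) (t : Tableau a b) :
    youngLin a b j f t = diagCoeff t.row j * f t + offCoeff t.row j * f (swapTab j t) := by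
  rw [youngLin_apply]
  by_cases hc : offCoeff t.row j = 0
  · simp [hc]
  · have h := t.isTableau.swap hj hc
    rw [swapTab_of h, extend_of _ h]

theorem youngLin_symm {a b j : ℕ} (hj : j + 1 < a + b) (f g : Specht a b) :
    inner ℂ (youngLin a b j f) g = inner ℂ f (youngLin a b j g) := by
  simp only [PiLp.inner_apply, RCLike.inner_apply, youngLin_apply' hj, map_add, map_mul, mul_add,
    add_mul, Finset.sum_add_distrib]
  have hd : ∀ t : Tableau a b, (starRingEnd ℂ) (diagCoeff t.row j) = diagCoeff t.row j :=
    fun t => Complex.conj_ofReal _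
  have ho : ∀ t : Tableau a b, (starRingEnd ℂ) (offCoeff t.row j) = offCoeff t.row j :=
    fun t => Complex.conj_ofReal _
  simp only [hd, ho]
  congr 1
  · exact Finset.sum_congr rfl fun t _ => by ring
  · refine Finset.sum_bij' (fun t _ => swapTab j t) (fun t _ => swapTab j t) (by simp) (by simp)
      (fun t _ => swapTab_swapTab j t) (fun t _ => swapTab_swapTab j t) fun t _ => ?_
    rw [swapTab_swapTab, offCoeff_swapTab]
    ring

open Classical in
/-- The operator `youngLin` as an isometry (for `j + 1 < a + b`; the value for other `j` is not
used). -/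
noncomputable def youngOp (a b j : ℕ) : Specht a b →ₗᵢ[ℂ] Specht a b :=
  if hj : j + 1 < a + b then
    (youngLin a b j).isometryOfInner fun f g => by rw [youngLin_symm hj, youngLin_sq hj]
  else 1

theorem youngOp_apply {a b j : ℕ} (hj : j + 1 < a + b) (f : Specht a b) :
    youngOp a b j f = youngLin a b j f := by
  simp [youngOp, hj]

/-- Young's orthogonal form: `σ_j t = r⁻¹ t + √(1 - r⁻²) σ_j t` on basis vectors. -/
theorem youngOp_single {a b j : ℕ} (hj : j + 1 < a + b) (t : Tableau a b) :
    youngOp a b j (EuclideanSpace.single t 1) =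
      diagCoeff t.row j • EuclideanSpace.single t (1 : ℂ)
        + offCoeff t.row j • EuclideanSpace.single (swapTab j t) (1 : ℂ) := by
  rw [youngOp_apply hj]
  ext s
  rw [youngLin_apply' hj]
  simp only [PiLp.add_apply, PiLp.smul_apply, PiLp.single_apply, smul_eq_mul]
  have h1 : swapTab j s = t ↔ s = swapTab j t := by
    constructor
    · rintro rfl; rw [swapTab_swapTab]
    · rintro rfl; rw [swapTab_swapTab]
  congr 1
  · by_cases h : s = t
    · simp [h]
    · simp [h]
  · by_cases h : s = swapTab j t
    · simp [h, swapTab_swapTab, offCoeff_swapTab]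
    · simp [h, h1]

/-! ### The symmetric groups `𝔖_N` and `𝔖_ℕ` -/

/-- The subgroup `𝔖_N` of the permutations of `ℕ` that fix every `x ≥ N`. -/
def symN (N : ℕ) : Subgroup (Equiv.Perm ℕ) where
  carrier := {g | ∀ x, N ≤ x → g x = x}
  one_mem' := fun _ _ => rfl
  mul_mem' := fun {g h} hg hh x hx => by rw [Equiv.Perm.mul_apply, hh x hx, hg x hx]
  inv_mem' := fun {g} hg x hx => by rw [Equiv.Perm.inv_eq_iff_eq, hg x hx]

theorem symN_mono {M N : ℕ} (h : M ≤ N) : symN M ≤ symN N := fun _ hg x hx => hg x (h.trans hx)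

/-- The infinite symmetric group `𝔖_ℕ`, the union of the groups `𝔖_N`. -/
def symInf : Subgroup (Equiv.Perm ℕ) where
  carrier := {g | ∃ N, g ∈ symN N}
  one_mem' := ⟨0, one_mem _⟩
  mul_mem' := fun ⟨M, hM⟩ ⟨N, hN⟩ => ⟨max M N, mul_mem (symN_mono (le_max_left _ _) hM)
    (symN_mono (le_max_right _ _) hN)⟩
  inv_mem' := fun ⟨N, hN⟩ => ⟨N, inv_mem hN⟩

/-- The Coxeter transposition `(j, j + 1)`. -/
def cox (j : ℕ) : Equiv.Perm ℕ := Equiv.swap j (j + 1)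

theorem cox_mem {j N : ℕ} (h : j + 1 < N) : cox j ∈ symN N := fun x hx =>
  Equiv.swap_apply_of_ne_of_ne (by omega) (by omega)

/-- `σ i * σ (i+1) * ⋯ * σ (N-1)` -/
def chain {M : Type*} [Monoid M] (σ : ℕ → M) (i N : ℕ) : M := ((List.range' i (N - i)).map σ).prod

theorem chain_self {M : Type*} [Monoid M] (σ : ℕ → M) {i N : ℕ} (h : N ≤ i) : chain σ i N = 1 := by
  simp [chain, Nat.sub_eq_zero_of_le h]

theorem chain_step {M : Type*} [Monoid M] (σ : ℕ → M) {i N : ℕ} (h : i < N) :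
    chain σ i N = σ i * chain σ (i + 1) N := by
  obtain ⟨m, rfl⟩ := Nat.exists_eq_add_of_lt h
  simp only [chain]
  rw [show i + m + 1 - i = m + 1 by omega, show i + m + 1 - (i + 1) = m by omega]
  simp [List.range'_succ]

/-- The product of the `σ_j` along the standard word for the permutation `g ∈ 𝔖_N` in the Coxeter
transpositions. -/
def coxLift {M : Type*} [Monoid M] (σ : ℕ → M) : ℕ → Equiv.Perm ℕ → M
  | 0, _ => 1
  | N + 1, g => chain σ (g N) N * coxLift σ N ((chain cox (g N) N)⁻¹ * g)

/-- The Coxeter relations of `𝔖_N`. -/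
structure CoxRel {M : Type*} [Monoid M] (N : ℕ) (σ : ℕ → M) : Prop where
  sq : ∀ j, j + 1 < N → σ j * σ j = 1
  comm : ∀ i j, i + 2 ≤ j → j + 1 < N → σ i * σ j = σ j * σ i
  braid : ∀ j, j + 2 < N → σ j * σ (j + 1) * σ j = σ (j + 1) * σ j * σ (j + 1)

theorem CoxRel.mono {M : Type*} [Monoid M] {N N' : ℕ} {σ : ℕ → M} (h : CoxRel N' σ) (hN : N ≤ N') :
    CoxRel N σ :=
  ⟨fun j hj => h.sq j (by omega), fun i j hij hj => h.comm i j hij (by omega),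
    fun j hj => h.braid j (by omega)⟩

theorem coxRel_cox (N : ℕ) : CoxRel N cox where
  sq j _ := Equiv.swap_mul_self _ _
  comm i j hij _ := by
    apply Equiv.Perm.Disjoint.commute
    intro x
    by_cases h : x = i ∨ x = i + 1
    · right; exact Equiv.swap_apply_of_ne_of_ne (by omega) (by omega)
    · left; exact Equiv.swap_apply_of_ne_of_ne (by omega) (by omega)
  braid j _ := by
    simp only [cox]
    rw [Equiv.swap_mul_swap_mul_swap (by omega) (by omega),
      Equiv.swap_comm j (j + 1), Equiv.swap_comm (j + 1) (j + 1 + 1),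
      Equiv.swap_mul_swap_mul_swap (by omega) (by omega), Equiv.swap_comm]

theorem CoxRel.chain_comm {M : Type*} [Monoid M] {N : ℕ} {σ : ℕ → M} (h : CoxRel (N + 1) σ)
    {i j : ℕ} (hij : j + 1 < i) : σ j * chain σ i N = chain σ i N * σ j := by
  induction hm : N - i generalizing i with
  | zero => rw [chain_self σ (by omega)]; simp
  | succ m ih =>
    rw [chain_step σ (by omega), ← mul_assoc, h.comm j i (by omega) (by omega), mul_assoc,
      ih (by omega) (by omega), mul_assoc]

theorem CoxRel.chain_shift {M : Type*} [Monoid M] {N : ℕ} {σ : ℕ → M} (h : CoxRel (N + 1) σ)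
    {i j : ℕ} (hij : i ≤ j) (hj : j + 1 < N) :
    σ (j + 1) * chain σ i N = chain σ i N * σ j := by
  induction hm : j - i generalizing i with
  | zero =>
    obtain rfl : i = j := by omega
    rw [chain_step σ (by omega), chain_step σ (by omega)]
    calc σ (i + 1) * (σ i * (σ (i + 1) * chain σ (i + 1 + 1) N))
        = (σ (i + 1) * σ i * σ (i + 1)) * chain σ (i + 1 + 1) N := by simp only [mul_assoc]
      _ = σ i * σ (i + 1) * (σ i * chain σ (i + 1 + 1) N) := by
        rw [← h.braid i (by omega)]; simp only [mul_assoc]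
      _ = _ := by rw [h.chain_comm (by omega)]; simp only [mul_assoc]
  | succ m ih =>
    rw [chain_step σ (by omega), ← mul_assoc, ← h.comm i (j + 1) (by omega) (by omega), mul_assoc,
      ih (by omega) (by omega), mul_assoc]

theorem chain_cox_apply (i N : ℕ) (h : i ≤ N) : chain cox i N N = i := by
  induction hm : N - i generalizing i with
  | zero => rw [chain_self _ (by omega)]; simp; omega
  | succ m ih =>
    rw [chain_step _ (by omega), Equiv.Perm.mul_apply, ih (i + 1) (by omega) (by omega)]
    simp [cox]

theorem chain_cox_mem (i N : ℕ) : chain cox i N ∈ symN (N + 1) := by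
  induction hm : N - i generalizing i with
  | zero => rw [chain_self _ (by omega)]; exact one_mem _
  | succ m ih =>
    rw [chain_step _ (by omega)]
    exact mul_mem (cox_mem (by omega)) (ih (i + 1) (by omega))

theorem symN_apply_le {N : ℕ} {g : Equiv.Perm ℕ} (hg : g ∈ symN (N + 1)) : g N ≤ N := by
  by_contra h
  have h1 := hg (g N) (by omega)
  have := g.injective h1
  omega

theorem reduce_mem {N : ℕ} {g : Equiv.Perm ℕ} (hg : g ∈ symN (N + 1)) :
    (chain cox (g N) N)⁻¹ * g ∈ symN N := by
  intro x hx
  rcases Nat.eq_or_lt_of_le hx with rfl | hx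
  · rw [Equiv.Perm.mul_apply, Equiv.Perm.inv_eq_iff_eq, chain_cox_apply _ _ (symN_apply_le hg)]
  · exact (mul_mem (inv_mem (chain_cox_mem _ _)) hg) x hx

theorem symN_zero {g : Equiv.Perm ℕ} (hg : g ∈ symN 0) : g = 1 := Equiv.ext fun x => hg x (by omega)

theorem coxLift_one {M : Type*} [Monoid M] (σ : ℕ → M) (N : ℕ) : coxLift σ N 1 = 1 := by
  induction N with
  | zero => rfl
  | succ N ih => simp [coxLift, chain_self, ih]

theorem coxLift_cox_mul {M : Type*} [Monoid M] {σ : ℕ → M} {N : ℕ} (h : CoxRel N σ)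
    {g : Equiv.Perm ℕ} (hg : g ∈ symN N) {j : ℕ} (hj : j + 1 < N) :
    coxLift σ N (cox j * g) = σ j * coxLift σ N g := by
  induction N generalizing g j with
  | zero => omega
  | succ N ih =>
    have hr := reduce_mem hg
    have hc := coxRel_cox (N + 1)
    have hi := symN_apply_le hg
    simp only [coxLift, Equiv.Perm.mul_apply]
    rcases lt_trichotomy (j + 1) (g N) with h1 | h1 | h1
    · have e : cox j (g N) = g N := Equiv.swap_apply_of_ne_of_ne (by omega) (by omega)
      rw [e, ← mul_assoc (σ j), h.chain_comm h1, mul_assoc,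
        ← ih (h.mono (by omega)) hr (by omega)]
      congr 2
      rw [← mul_assoc, ← mul_assoc, inv_mul_eq_iff_eq_mul.mpr]
      rw [← mul_assoc, ← hc.chain_comm h1]
      simp
    · have e : cox j (g N) = j := by rw [← h1]; simp [cox]
      rw [e, chain_step σ (by omega), chain_step cox (by omega), h1, mul_assoc]
      congr 3
      rw [mul_inv_rev, mul_assoc, inv_mul_cancel_left]
    · rcases Nat.eq_or_lt_of_le (show g N ≤ j by omega) with h2 | h2
      · have e : cox j (g N) = j + 1 := by rw [h2]; simp [cox]
        rw [e, h2, chain_step σ (i := j) (by omega), chain_step cox (i := j) (by omega), mul_assoc,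
          ← mul_assoc (σ j) (σ j), h.sq j (by omega), one_mul]
        congr 2
      · obtain ⟨m, rfl⟩ : ∃ m, j = m + 1 := ⟨j - 1, by omega⟩
        have e : cox (m + 1) (g N) = g N := Equiv.swap_apply_of_ne_of_ne (by omega) (by omega)
        rw [e, ← mul_assoc (σ (m + 1)), h.chain_shift (by omega) (by omega), mul_assoc,
          ← ih (h.mono (by omega)) hr (by omega)]
        congr 2
        rw [← mul_assoc, ← mul_assoc, inv_mul_eq_iff_eq_mul.mpr]
        rw [← mul_assoc, ← hc.chain_shift (by omega) (by omega)]
        simp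

theorem symN_induction {N : ℕ} {P : Equiv.Perm ℕ → Prop} (h1 : P 1)
    (hs : ∀ j g, j + 1 < N → g ∈ symN N → P g → P (cox j * g)) {g : Equiv.Perm ℕ}
    (hg : g ∈ symN N) : P g := by
  induction N generalizing g with
  | zero => rw [symN_zero hg]; exact h1
  | succ N ih =>
    have h2 : ∀ i, P (chain cox i N * ((chain cox (g N) N)⁻¹ * g)) := by
      intro i
      induction hm : N - i generalizing i with
      | zero =>
        rw [chain_self _ (by omega), one_mul]
        exact ih (fun j g hj hg => hs j g (by omega) (symN_mono (by omega) hg)) (reduce_mem hg)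
      | succ m ihm =>
        rw [chain_step _ (by omega), mul_assoc]
        exact hs _ _ (by omega) (mul_mem (chain_cox_mem _ _) (symN_mono (by omega) (reduce_mem hg)))
          (ihm (i + 1) (by omega))
    simpa using h2 (g N)

theorem coxLift_mul {M : Type*} [Monoid M] {σ : ℕ → M} {N : ℕ} (h : CoxRel N σ)
    {g g' : Equiv.Perm ℕ} (hg : g ∈ symN N) (hg' : g' ∈ symN N) :
    coxLift σ N (g * g') = coxLift σ N g * coxLift σ N g' := by
  have key : g ∈ symN N ∧ coxLift σ N (g * g') = coxLift σ N g * coxLift σ N g' := by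
    refine symN_induction (P := fun g => g ∈ symN N ∧
      coxLift σ N (g * g') = coxLift σ N g * coxLift σ N g') ?_ ?_ hg
    · exact ⟨one_mem _, by rw [one_mul, coxLift_one, one_mul]⟩
    · rintro j k hj hk ⟨-, ih⟩
      refine ⟨mul_mem (cox_mem hj) hk, ?_⟩
      rw [mul_assoc, coxLift_cox_mul h (mul_mem hk hg') hj, ih, coxLift_cox_mul h hk hj, mul_assoc]
  exact key.2

/-- The homomorphism from `𝔖_N` that sends `(j, j + 1)` to `σ j` (see `coxHom_cox`). -/
def coxHom {M : Type*} [Monoid M] {σ : ℕ → M} {N : ℕ} (h : CoxRel N σ) : symN N →* M where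
  toFun g := coxLift σ N g
  map_one' := coxLift_one σ N
  map_mul' g g' := coxLift_mul h g.2 g'.2

theorem coxHom_cox {M : Type*} [Monoid M] {σ : ℕ → M} {N : ℕ} (h : CoxRel N σ) {j : ℕ}
    (hj : j + 1 < N) : coxHom h ⟨cox j, cox_mem hj⟩ = σ j := by
  have := coxLift_cox_mul h (one_mem _) hj
  rwa [mul_one, coxLift_one, mul_one] at this

theorem coxRel_youngOp (a b : ℕ) : CoxRel (a + b) (youngOp a b) where
  sq j hj := LinearIsometry.ext fun f => by
    simp only [LinearIsometry.coe_mul, Function.comp_apply, LinearIsometry.coe_one, id_eq,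
      youngOp_apply hj, youngLin_sq hj]
  comm i j hij hj := LinearIsometry.ext fun f => by
    have hi : i + 1 < a + b := by omega
    simp only [LinearIsometry.coe_mul, Function.comp_apply, youngOp_apply hj, youngOp_apply hi]
    exact youngLin_comm hi hj (Or.inl hij) f
  braid j hj := LinearIsometry.ext fun f => by
    have hi : j + 1 < a + b := by omega
    simp only [LinearIsometry.coe_mul, Function.comp_apply, youngOp_apply (j := j + 1) hj,
      youngOp_apply hi]
    exact youngLin_braid hj f

/-- The irreducible unitary representation `π_λ` of `𝔖_N`, `λ = (a, b)`, `N = a + b`, in Young's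
orthogonal form. -/
noncomputable def spechtRep (a b : ℕ) : symN (a + b) →* (Specht a b →ₗᵢ[ℂ] Specht a b) :=
  coxHom (coxRel_youngOp a b)

theorem spechtRep_cox {a b j : ℕ} (hj : j + 1 < a + b) :
    spechtRep a b ⟨cox j, cox_mem hj⟩ = youngOp a b j := coxHom_cox _ hj

/-! ### The embeddings `π_{(a,b)} ↪ π_{(a+1,b+1)}` -/

/-- Put the entry `N` into row `r` and the entry `N + 1` into the other row. -/
def addWord (w : ℕ → Fin 2) (N : ℕ) (r : Fin 2) : ℕ → Fin 2 :=
  fun m => if m < N then w m else if m = N then r else if m = N + 1 then 1 - r else 0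

theorem addWord_isTableau {a b : ℕ} (hab : b < a) {w : ℕ → Fin 2} (h : IsTableau a b w)
    (r : Fin 2) : IsTableau (a + 1) (b + 1) (addWord w (a + b) r) := by
  have hN : a + 1 + (b + 1) = a + b + 1 + 1 := by omega
  have hlo : ∀ i m, m ≤ a + b → rowLen (addWord w (a + b) r) i m = rowLen w i m := fun i m hm =>
    rowLen_congr i m fun x hx => by simp [addWord, show x < a + b by omega]
  have e1 : addWord w (a + b) r (a + b) = r := by simp [addWord]
  have e2 : addWord w (a + b) r (a + b + 1) = 1 - r := by simp [addWord]
  have l0 := h.len_zero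
  have l1 := h.len_one
  refine ⟨fun m hm => ?_, ?_, ?_, fun m hm => ?_⟩
  · simp [addWord, show ¬ m < a + b by omega, show m ≠ a + b by omega, show m ≠ a + b + 1 by omega]
  · rw [hN, rowLen_succ, rowLen_succ, e1, e2, hlo _ _ le_rfl, l0]
    rcases fin2 r with rfl | rfl <;> simp
  · rw [hN, rowLen_succ, rowLen_succ, e1, e2, hlo _ _ le_rfl, l1]
    rcases fin2 r with rfl | rfl <;> simp
  · rcases Nat.lt_or_ge (a + b) m with h1 | h1
    · obtain h2 | h2 : m = a + b + 1 ∨ m = a + b + 1 + 1 := by omega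
      · rw [h2, rowLen_succ, rowLen_succ, e1, hlo _ _ le_rfl, hlo _ _ le_rfl, l0, l1]
        rcases fin2 r with rfl | rfl <;> simp <;> omega
      · rw [h2, rowLen_succ, rowLen_succ, rowLen_succ, rowLen_succ, e1, e2, hlo _ _ le_rfl,
          hlo _ _ le_rfl, l0, l1]
        rcases fin2 r with rfl | rfl <;> simp <;> omega
    · rw [hlo _ _ h1, hlo _ _ h1]; exact h.ballot m h1

/-- Extend a tableau of shape `(a, b)` to one of shape `(a + 1, b + 1)`. The extension by `t₂₁` (the
first new entry goes to the second row, the second one to the first row) is the case `r = 1`, the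
extension by `t₁₂` is the case `r = 0`. -/
def addTab {a b : ℕ} (hab : b < a) (r : Fin 2) (t : Tableau a b) : Tableau (a + 1) (b + 1) :=
  ⟨addWord t.row (a + b) r, addWord_isTableau hab t.isTableau r⟩

theorem addTab_inj {a b : ℕ} (hab : b < a) {r r' : Fin 2} {t t' : Tableau a b}
    (h : addTab hab r t = addTab hab r' t') : t = t' ∧ r = r' := by
  have h1 : ∀ m, addWord t.row (a + b) r m = addWord t'.row (a + b) r' m :=
    fun m => congrArg (fun s => s.row m) h
  refine ⟨Tableau.ext (funext fun m => ?_), ?_⟩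
  · by_cases hm : m < a + b
    · simpa [addWord, hm] using h1 m
    · rw [t.isTableau.pad m (by omega), t'.isTableau.pad m (by omega)]
  · simpa [addWord] using h1 (a + b)

/-- The unit vectors `h = h₀ t₂₁ + h₁ t₁₂` of the two-dimensional space `H^{1,1}` with orthonormal
basis `{t₂₁, t₁₂}`. -/
abbrev UnitVec : Type := Metric.sphere (0 : EuclideanSpace ℂ (Fin 2)) 1

/-- The image `h₀ (t, t₂₁) + h₁ (t, t₁₂)` of the tableau `t`. -/
noncomputable def embVec {a b : ℕ} (hab : b < a) (h : UnitVec) (t : Tableau a b) :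
    Specht (a + 1) (b + 1) :=
  h.1 0 • EuclideanSpace.single (addTab hab 1 t) (1 : ℂ)
    + h.1 1 • EuclideanSpace.single (addTab hab 0 t) (1 : ℂ)

theorem embVec_orthonormal {a b : ℕ} (hab : b < a) (h : UnitVec) :
    Orthonormal ℂ (embVec (b := b) hab h) := by
  have hn : ‖h.1 0‖ ^ 2 + ‖h.1 1‖ ^ 2 = 1 := by
    have h1 : ‖h.1‖ = 1 := by simp
    have h2 := EuclideanSpace.norm_sq_eq h.1
    rw [h1, Fin.sum_univ_two] at h2
    linarith
  have hn' : h.1 0 * (starRingEnd ℂ) (h.1 0) + h.1 1 * (starRingEnd ℂ) (h.1 1) = 1 := by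
    rw [Complex.mul_conj', Complex.mul_conj', ← Complex.ofReal_pow, ← Complex.ofReal_pow,
      ← Complex.ofReal_add, hn, Complex.ofReal_one]
  rw [orthonormal_iff_ite]
  intro t t'
  have hne : ∀ {r r' : Fin 2}, r ≠ r' → ¬ (addTab hab r t = addTab hab r' t') :=
    fun hr h => hr (addTab_inj hab h).2
  have heq : ∀ r, addTab hab r t = addTab hab r t' ↔ t = t' :=
    fun r => ⟨fun h => (addTab_inj hab h).1, fun h => by rw [h]⟩
  simp only [embVec, inner_add_left, inner_add_right, inner_smul_left, inner_smul_right,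
    EuclideanSpace.inner_single_left, PiLp.single_apply, heq, map_one, one_mul]
  rw [if_neg (hne (by decide)), if_neg (hne (by decide))]
  split_ifs
  · linear_combination hn'
  · simp

/-- The isometric embedding `π_{(a,b)} ↪ π_{(a+1,b+1)}` determined by the unit vector `h`. -/
noncomputable def emb {a b : ℕ} (hab : b < a) (h : UnitVec) :
    Specht a b →ₗᵢ[ℂ] Specht (a + 1) (b + 1) :=
  LinearMap.isometryOfOrthonormal
    ((EuclideanSpace.basisFun (Tableau a b) ℂ).toBasis.constr ℂ (embVec hab h))
    (v := (EuclideanSpace.basisFun (Tableau a b) ℂ).toBasis)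
    (by simp)
    (by
      have : ⇑((EuclideanSpace.basisFun (Tableau a b) ℂ).toBasis.constr ℂ (embVec hab h)) ∘
          ⇑(EuclideanSpace.basisFun (Tableau a b) ℂ).toBasis = embVec hab h :=
        funext fun t => Module.Basis.constr_basis _ _ _ _
      rw [this]; exact embVec_orthonormal hab h)

theorem emb_single {a b : ℕ} (hab : b < a) (h : UnitVec) (t : Tableau a b) :
    emb hab h (EuclideanSpace.single t 1) =
      h.1 0 • EuclideanSpace.single (addTab hab 1 t) (1 : ℂ)
        + h.1 1 • EuclideanSpace.single (addTab hab 0 t) (1 : ℂ) := by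
  have e : emb hab h ((EuclideanSpace.basisFun (Tableau a b) ℂ).toBasis t) = embVec hab h t :=
    Module.Basis.constr_basis (EuclideanSpace.basisFun (Tableau a b) ℂ).toBasis ℂ (embVec hab h) t
  rwa [OrthonormalBasis.coe_toBasis, EuclideanSpace.basisFun_apply] at e

theorem axialDist_congr {w v : ℕ → Fin 2} {j : ℕ} (h : ∀ i < j + 2, w i = v i) :
    axialDist w j = axialDist v j := by
  simp only [axialDist, content, h j (by omega), h (j + 1) (by omega),
    rowLen_congr _ j fun i hi => h i (by omega), rowLen_congr _ (j + 1) fun i hi => h i (by omega)]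

theorem swapWord_addWord (w : ℕ → Fin 2) {N j : ℕ} (hj : j + 1 < N) (r : Fin 2) :
    swapWord (addWord w N r) j = addWord (swapWord w j) N r := by
  funext m
  by_cases h1 : m = j
  · subst h1; simp [swapWord_apply_left, addWord, hj, show m < N by omega]
  by_cases h2 : m = j + 1
  · subst h2; simp [swapWord_apply_right, addWord, hj, show j < N by omega]
  rw [swapWord_apply_of_ne _ h1 h2]
  simp [addWord, swapWord_apply_of_ne _ h1 h2]

theorem emb_youngOp {a b j : ℕ} (hab : b < a) (h : UnitVec) (hj : j + 1 < a + b) (f : Specht a b) :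
    emb hab h (youngOp a b j f) = youngOp (a + 1) (b + 1) j (emb hab h f) := by
  have key : (emb hab h).toLinearMap ∘ₗ (youngOp a b j).toLinearMap
      = (youngOp (a + 1) (b + 1) j).toLinearMap ∘ₗ (emb hab h).toLinearMap := by
    refine (EuclideanSpace.basisFun (Tableau a b) ℂ).toBasis.ext fun t => ?_
    have hj' : j + 1 < a + 1 + (b + 1) := by omega
    have hax : ∀ r, axialDist (addTab hab r t).row j = axialDist t.row j := fun r =>
      axialDist_congr fun i hi => by simp [addTab, addWord, show i < a + b by omega]
    have hd : ∀ r, diagCoeff (addTab hab r t).row j = diagCoeff t.row j := fun r => by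
      simp [diagCoeff, hax]
    have ho : ∀ r, offCoeff (addTab hab r t).row j = offCoeff t.row j := fun r => by
      simp [offCoeff, hax]
    simp only [OrthonormalBasis.coe_toBasis, EuclideanSpace.basisFun_apply,
      LinearMap.comp_apply, LinearIsometry.coe_toLinearMap, youngOp_single hj, emb_single, map_add,
      map_smul, youngOp_single hj', hd, ho]
    by_cases hc : offCoeff t.row j = 0
    · simp only [hc, zero_smul, add_zero]
      module
    · have hs := t.isTableau.swap hj hc
      have e : ∀ r, swapTab j (addTab hab r t) = addTab hab r (swapTab j t) := fun r => by
        have e1 : swapWord (addTab hab r t).row j = addWord (swapWord t.row j) (a + b) r :=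
          swapWord_addWord _ hj r
        have h2 : IsTableau (a + 1) (b + 1) (swapWord (addTab hab r t).row j) := by
          rw [e1]; exact addWord_isTableau hab hs r
        rw [swapTab_of h2, swapTab_of hs]
        apply Tableau.ext
        exact e1
      simp only [e]
      module
  exact congrArg (fun l : Specht a b →ₗ[ℂ] Specht (a + 1) (b + 1) => l f) key

/-- The embedding is equivariant with respect to `𝔖_N ⊂ 𝔖_{N+2}`. -/
theorem emb_spechtRep {a b : ℕ} (hab : b < a) (h : UnitVec) {g : Equiv.Perm ℕ}
    (hg : g ∈ symN (a + b)) (hg' : g ∈ symN (a + 1 + (b + 1))) (f : Specht a b) :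
    emb hab h (spechtRep a b ⟨g, hg⟩ f) = spechtRep (a + 1) (b + 1) ⟨g, hg'⟩ (emb hab h f) := by
  revert f hg'
  have key : g ∈ symN (a + b) ∧ ∀ f, emb hab h (coxLift (youngOp a b) (a + b) g f)
      = coxLift (youngOp (a + 1) (b + 1)) (a + 1 + (b + 1)) g (emb hab h f) := by
    refine symN_induction (P := fun g => g ∈ symN (a + b) ∧
      ∀ f, emb hab h (coxLift (youngOp a b) (a + b) g f)
      = coxLift (youngOp (a + 1) (b + 1)) (a + 1 + (b + 1)) g (emb hab h f)) ?_ ?_ hg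
    · exact ⟨one_mem _, fun f => by rw [coxLift_one, coxLift_one]; rfl⟩
    · rintro j k hj hk ⟨-, ih⟩
      refine ⟨mul_mem (cox_mem hj) hk, fun f => ?_⟩
      rw [coxLift_cox_mul (coxRel_youngOp a b) hk hj,
        coxLift_cox_mul (coxRel_youngOp (a + 1) (b + 1)) (symN_mono (by omega) hk) (by omega)]
      simp only [LinearIsometry.coe_mul, Function.comp_apply]
      rw [emb_youngOp hab h hj, ih]
  exact fun _ f => key.2 f


/-! ### Inductive limits of Hilbert spaces along isometries -/

section Limit

variable {E : ℕ → Type*} [∀ n, NormedAddCommGroup (E n)] [∀ n, InnerProductSpace ℂ (E n)]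

/-- The composition `E i ↪ E (i + 1) ↪ ⋯ ↪ E j`. -/
noncomputable def transition (ι : ∀ n, E n →ₗᵢ[ℂ] E (n + 1)) (i j : ℕ) (h : i ≤ j) :
    E i →ₗᵢ[ℂ] E j :=
  Nat.leRec (motive := fun j _ => E i →ₗᵢ[ℂ] E j) LinearIsometry.id
    (fun j _ f => (ι j).comp f) h

theorem transition_self (ι : ∀ n, E n →ₗᵢ[ℂ] E (n + 1)) (i : ℕ) (h : i ≤ i) :
    transition ι i i h = LinearIsometry.id := Nat.leRec_self ..

theorem transition_succ (ι : ∀ n, E n →ₗᵢ[ℂ] E (n + 1)) (i j : ℕ) (h : i ≤ j) :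
    transition ι i (j + 1) (by omega) = (ι j).comp (transition ι i j h) := Nat.leRec_succ ..

instance (ι : ∀ n, E n →ₗᵢ[ℂ] E (n + 1)) :
    DirectedSystem E (fun i j h => transition ι i j h) where
  map_self i x := by rw [transition_self]; rfl
  map_map := by
    intro k j i hij hjk x
    induction k, hjk using Nat.le_induction with
    | base => rw [transition_self]; rfl
    | succ k hk ih =>
      rw [transition_succ ι j k hk, transition_succ ι i k (by omega)]
      exact congrArg (ι k) ih

/-- The algebraic inductive limit of the chain `E 0 ↪ E 1 ↪ E 2 ↪ ⋯`. -/
abbrev AlgLimit (ι : ∀ n, E n →ₗᵢ[ℂ] E (n + 1)) : Type _ := DirectLimit E (transition ι)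

/-- The canonical map of `E n` into the inductive limit. -/
noncomputable def AlgLimit.of (ι : ∀ n, E n →ₗᵢ[ℂ] E (n + 1)) (n : ℕ) : E n →ₗ[ℂ] AlgLimit ι :=
  DirectLimit.Module.of ℂ ℕ E (transition ι) n

/-- The inner product on the inductive limit that extends those of the spaces `E n`. -/
noncomputable def AlgLimit.innerFun (ι : ∀ n, E n →ₗᵢ[ℂ] E (n + 1)) :
    AlgLimit ι → AlgLimit ι → ℂ :=
  DirectLimit.lift₂ _ _ (fun _ x y => inner ℂ x y)
    (fun i j h x y => ((transition ι i j h).inner_map_map x y).symm)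

theorem AlgLimit.innerFun_of (ι : ∀ n, E n →ₗᵢ[ℂ] E (n + 1)) (n : ℕ) (x y : E n) :
    AlgLimit.innerFun ι (AlgLimit.of ι n x) (AlgLimit.of ι n y) = inner ℂ x y :=
  DirectLimit.lift₂_def ..

@[reducible]
noncomputable def AlgLimit.core (ι : ∀ n, E n →ₗᵢ[ℂ] E (n + 1)) :
    InnerProductSpace.Core ℂ (AlgLimit ι) where
  inner := AlgLimit.innerFun ι
  conj_inner_symm := DirectLimit.induction₂ _ fun n x y => by
    refine Eq.trans ?_ (AlgLimit.innerFun_of ι n x y).symm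
    refine Eq.trans ?_ (inner_conj_symm x y)
    exact congrArg _ (AlgLimit.innerFun_of ι n y x)
  re_inner_nonneg := DirectLimit.induction _ fun n x => by
    refine le_of_le_of_eq (inner_self_nonneg (𝕜 := ℂ) (x := x)) ?_
    exact congrArg _ (AlgLimit.innerFun_of ι n x x).symm
  add_left := DirectLimit.induction₃ _ fun n x y z => by
    refine Eq.trans ?_ ((inner_add_left x y z).trans ?_)
    · refine Eq.trans ?_ (AlgLimit.innerFun_of ι n (x + y) z)
      rw [map_add]; rfl
    · rw [← AlgLimit.innerFun_of ι n x z, ← AlgLimit.innerFun_of ι n y z]; rfl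
  smul_left := DirectLimit.induction₂ _ fun n x y r => by
    refine Eq.trans ?_ ((inner_smul_left x y r).trans ?_)
    · refine Eq.trans ?_ (AlgLimit.innerFun_of ι n (r • x) y)
      rw [map_smul]; rfl
    · rw [← AlgLimit.innerFun_of ι n x y]; rfl
  definite := DirectLimit.induction _ fun n x hx => by
    have h : inner ℂ x x = 0 := (AlgLimit.innerFun_of ι n x x).symm.trans hx
    rw [inner_self_eq_zero] at h
    subst h
    exact map_zero (AlgLimit.of ι n)

noncomputable instance (ι : ∀ n, E n →ₗᵢ[ℂ] E (n + 1)) : NormedAddCommGroup (AlgLimit ι) :=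
  (AlgLimit.core ι).toNormedAddCommGroup

noncomputable instance (ι : ∀ n, E n →ₗᵢ[ℂ] E (n + 1)) : InnerProductSpace ℂ (AlgLimit ι) :=
  InnerProductSpace.ofCore (AlgLimit.core ι).toCore

theorem AlgLimit.inner_of (ι : ∀ n, E n →ₗᵢ[ℂ] E (n + 1)) (n : ℕ) (x y : E n) :
    inner ℂ (AlgLimit.of ι n x) (AlgLimit.of ι n y) = inner ℂ x y := AlgLimit.innerFun_of ι n x y

theorem AlgLimit.of_transition (ι : ∀ n, E n →ₗᵢ[ℂ] E (n + 1)) {i j : ℕ} (h : i ≤ j) (x : E i) :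
    AlgLimit.of ι j (transition ι i j h x) = AlgLimit.of ι i x := DirectLimit.Module.of_f

theorem AlgLimit.exists_of (ι : ∀ n, E n →ₗᵢ[ℂ] E (n + 1)) (m : ℕ) (z : AlgLimit ι) :
    ∃ n, m ≤ n ∧ ∃ x, z = AlgLimit.of ι n x := by
  obtain ⟨i, x, rfl⟩ := DirectLimit.exists_eq_mk _ z
  exact ⟨max i m, le_max_right _ _, transition ι i (max i m) (le_max_left _ _) x,
    (AlgLimit.of_transition ι (le_max_left _ _) x).symm⟩

/-- The operators `T n` agree with the embeddings from level `m` on. -/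
def EventuallyIntertwines (ι : ∀ n, E n →ₗᵢ[ℂ] E (n + 1)) (m : ℕ)
    (T : ∀ n, E n →ₗᵢ[ℂ] E n) : Prop :=
  ∀ n, m ≤ n → ∀ x, ι n (T n x) = T (n + 1) (ι n x)

theorem EventuallyIntertwines.transition {ι : ∀ n, E n →ₗᵢ[ℂ] E (n + 1)} {m : ℕ}
    {T : ∀ n, E n →ₗᵢ[ℂ] E n} (hT : EventuallyIntertwines ι m T) {i j : ℕ} (hi : m ≤ i) (hij : i ≤ j)
    (x : E i) : transition ι i j hij (T i x) = T j (transition ι i j hij x) := by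
  induction j, hij using Nat.le_induction with
  | base => rw [transition_self]; rfl
  | succ j hj ih =>
    rw [transition_succ ι i j hj]
    exact (congrArg (ι j) ih).trans (hT j (hi.trans hj) _)

/-- The operator on the inductive limit induced by operators that agree with the embeddings from
level `m` on. -/
noncomputable def AlgLimit.mapLin {ι : ∀ n, E n →ₗᵢ[ℂ] E (n + 1)} {m : ℕ}
    {T : ∀ n, E n →ₗᵢ[ℂ] E n} (hT : EventuallyIntertwines ι m T) : AlgLimit ι →ₗ[ℂ] AlgLimit ι :=
  DirectLimit.Module.lift ℂ ℕ E (transition ι)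
    (fun n => AlgLimit.of ι (max n m) ∘ₗ (T (max n m)).toLinearMap ∘ₗ
      (transition ι n (max n m) (le_max_left _ _)).toLinearMap)
    (fun i j hij x => by
      have h : max i m ≤ max j m := max_le_max_right _ hij
      simp only [LinearMap.comp_apply, LinearIsometry.coe_toLinearMap]
      rw [← AlgLimit.of_transition ι h, hT.transition (le_max_right _ _) h,
        DirectedSystem.map_map' (transition ι), DirectedSystem.map_map' (transition ι)])

theorem AlgLimit.mapLin_of {ι : ∀ n, E n →ₗᵢ[ℂ] E (n + 1)} {m : ℕ}
    {T : ∀ n, E n →ₗᵢ[ℂ] E n} (hT : EventuallyIntertwines ι m T) {n : ℕ} (hn : m ≤ n) (x : E n) :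
    AlgLimit.mapLin hT (AlgLimit.of ι n x) = AlgLimit.of ι n (T n x) := by
  have h := hT.transition hn (le_max_left n m) x
  rw [← AlgLimit.of_transition ι (le_max_left n m) (T n x), h]
  rfl

/-- The operator `AlgLimit.mapLin` as an isometry. -/
noncomputable def AlgLimit.map {ι : ∀ n, E n →ₗᵢ[ℂ] E (n + 1)} {m : ℕ}
    {T : ∀ n, E n →ₗᵢ[ℂ] E n} (hT : EventuallyIntertwines ι m T) : AlgLimit ι →ₗᵢ[ℂ] AlgLimit ι where
  toLinearMap := AlgLimit.mapLin hT
  norm_map' z := by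
    obtain ⟨n, hn, x, rfl⟩ := AlgLimit.exists_of ι m z
    rw [AlgLimit.mapLin_of hT hn, @norm_eq_sqrt_re_inner ℂ, @norm_eq_sqrt_re_inner ℂ,
      AlgLimit.inner_of, AlgLimit.inner_of, (T n).inner_map_map]

theorem AlgLimit.map_of {ι : ∀ n, E n →ₗᵢ[ℂ] E (n + 1)} {m : ℕ}
    {T : ∀ n, E n →ₗᵢ[ℂ] E n} (hT : EventuallyIntertwines ι m T) {n : ℕ} (hn : m ≤ n) (x : E n) :
    AlgLimit.map hT (AlgLimit.of ι n x) = AlgLimit.of ι n (T n x) := AlgLimit.mapLin_of hT hn x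

end Limit

/-! ### Irreducible Schur--Weyl representations -/

/-- The embedding `π_{(k+n,n)} ↪ π_{(k+n+1,n+1)}` determined by `h n`. -/
noncomputable def step {k : ℕ} (hk : 0 < k) (h : ℕ → UnitVec) (n : ℕ) :
    Specht (k + n) n →ₗᵢ[ℂ] Specht (k + (n + 1)) (n + 1) :=
  emb (a := k + n) (b := n) (by omega) (h n)

/-- The algebraic inductive limit of the spaces of `π_{(k)}, π_{(k+1,1)}, π_{(k+2,2)}, …`. -/
abbrev PreSpace {k : ℕ} (hk : 0 < k) (h : ℕ → UnitVec) : Type :=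
  AlgLimit (E := fun n => Specht (k + n) n) (step hk h)

open Classical in
/-- The operator of `g` in `π_{(k+n,n)}`, for `n` so large that `g ∈ 𝔖_{k+2n}`. -/
noncomputable def levelOp (k : ℕ) (g : Equiv.Perm ℕ) (n : ℕ) :
    Specht (k + n) n →ₗᵢ[ℂ] Specht (k + n) n :=
  if hg : g ∈ symN (k + n + n) then spechtRep (k + n) n ⟨g, hg⟩ else 1

theorem levelOp_of (k : ℕ) {g : Equiv.Perm ℕ} {n : ℕ} (hg : g ∈ symN (k + n + n)) :
    levelOp k g n = spechtRep (k + n) n ⟨g, hg⟩ := by simp [levelOp, hg]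

theorem levelOp_intertwines {k : ℕ} (hk : 0 < k) (h : ℕ → UnitVec) {g : Equiv.Perm ℕ} {m : ℕ}
    (hg : g ∈ symN (k + m + m)) :
    EventuallyIntertwines (E := fun n => Specht (k + n) n) (step hk h) m (levelOp k g) := by
  intro n hn x
  have h1 : g ∈ symN (k + n + n) := symN_mono (by omega) hg
  have h2 : g ∈ symN (k + (n + 1) + (n + 1)) := symN_mono (by omega) hg
  rw [levelOp_of k h1, levelOp_of k h2]
  exact emb_spechtRep (by omega) (h n) h1 h2 x

/-- The action of `𝔖_ℕ` on the algebraic inductive limit (see `preRep_of`). -/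
noncomputable def preRep {k : ℕ} (hk : 0 < k) (h : ℕ → UnitVec) :
    symInf →* (PreSpace hk h →ₗᵢ[ℂ] PreSpace hk h) where
  toFun g := AlgLimit.map (levelOp_intertwines hk h (m := g.2.choose)
    (symN_mono (by omega) g.2.choose_spec))
  map_one' := LinearIsometry.ext fun z => by
    obtain ⟨n, hn, x, rfl⟩ := AlgLimit.exists_of _ (1 : symInf).2.choose z
    rw [AlgLimit.map_of _ hn]
    have : levelOp k ((1 : symInf) : Equiv.Perm ℕ) n = 1 :=
      (levelOp_of k (one_mem _)).trans (map_one (spechtRep (k + n) n))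
    rw [this]; rfl
  map_mul' g g' := LinearIsometry.ext fun z => by
    obtain ⟨n, hn, x, rfl⟩ := AlgLimit.exists_of _
      (max (g * g').2.choose (max g.2.choose g'.2.choose)) z
    have h1 : g.1 ∈ symN (k + n + n) := symN_mono (by omega) g.2.choose_spec
    have h2 : g'.1 ∈ symN (k + n + n) := symN_mono (by omega) g'.2.choose_spec
    rw [LinearIsometry.coe_mul, Function.comp_apply, AlgLimit.map_of _ (by omega),
      AlgLimit.map_of _ (by omega), AlgLimit.map_of _ (by omega)]
    congr 1
    rw [levelOp_of k h1, levelOp_of k h2, levelOp_of k (g := (g * g').1) (mul_mem h1 h2)]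
    exact congrArg (fun T : Specht (k + n) n →ₗᵢ[ℂ] Specht (k + n) n => T x)
      (map_mul (spechtRep (k + n) n) ⟨g, h1⟩ ⟨g', h2⟩)

/-- The restriction to the `n`-th space of the chain is `π_{(k+n,n)}`. -/
theorem preRep_of {k : ℕ} (hk : 0 < k) (h : ℕ → UnitVec) (g : symInf) (n : ℕ)
    (hg : g.1 ∈ symN (k + n + n)) (x : Specht (k + n) n) :
    preRep hk h g (AlgLimit.of (step hk h) n x)
      = AlgLimit.of (step hk h) n (spechtRep (k + n) n ⟨g.1, hg⟩ x) := by
  have e := (levelOp_intertwines hk h hg).transition le_rfl (le_max_left n g.2.choose) x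
  rw [levelOp_of k hg] at e
  rw [← AlgLimit.of_transition (step hk h) (le_max_left n g.2.choose) x,
    ← AlgLimit.of_transition (step hk h) (le_max_left n g.2.choose), e]
  exact AlgLimit.map_of _ (le_max_right _ _) _

/-- The Hilbert space of `Π_k(h)`: the completion of the algebraic inductive limit. -/
abbrev Space {k : ℕ} (hk : 0 < k) (h : ℕ → UnitVec) : Type :=
  UniformSpace.Completion (PreSpace hk h)

/-- The irreducible Schur--Weyl representation `Π_k(h)` of `𝔖_ℕ`, `k ≥ 1`: the inductive limit of
the irreducible representations of `𝔖_k, 𝔖_{k+2}, 𝔖_{k+4}, …` with the Young diagrams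
`(k), (k+1,1), (k+2,2), …` with respect to the embeddings determined by the unit vectors
`h 0, h 1, h 2, …`. -/
noncomputable def swRep {k : ℕ} (hk : 0 < k) (h : ℕ → UnitVec) :
    symInf →* (Space hk h →L[ℂ] Space hk h) where
  toFun g := (preRep hk h g).toContinuousLinearMap.completion
  map_one' := by
    ext z
    induction z using UniformSpace.Completion.induction_on with
    | hp => exact isClosed_eq (ContinuousLinearMap.continuous _) (ContinuousLinearMap.continuous _)
    | ih z => rw [ContinuousLinearMap.completion_apply_coe, map_one]; rfl
  map_mul' g g' := by
    ext z
    induction z using UniformSpace.Completion.induction_on with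
    | hp => exact isClosed_eq (ContinuousLinearMap.continuous _) (ContinuousLinearMap.continuous _)
    | ih z =>
      rw [mul_apply_eq_comp, ContinuousLinearMap.completion_apply_coe,
        ContinuousLinearMap.completion_apply_coe, ContinuousLinearMap.completion_apply_coe, map_mul]
      rfl

theorem swRep_of {k : ℕ} (hk : 0 < k) (h : ℕ → UnitVec) (g : symInf) (n : ℕ)
    (hg : g.1 ∈ symN (k + n + n)) (x : Specht (k + n) n) :
    swRep hk h g ((AlgLimit.of (step hk h) n x : PreSpace hk h) : Space hk h)
      = ((AlgLimit.of (step hk h) n (spechtRep (k + n) n ⟨g.1, hg⟩ x) : PreSpace hk h) :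
          Space hk h) := by
  rw [← preRep_of hk h g n hg x]
  exact ContinuousLinearMap.completion_apply_coe _ _

/-- The representation `Π_k(h)` is unitary. -/
theorem swRep_inner {k : ℕ} (hk : 0 < k) (h : ℕ → UnitVec) (g : symInf) (x y : Space hk h) :
    inner ℂ (swRep hk h g x) (swRep hk h g y) = inner ℂ x y := by
  induction x, y using UniformSpace.Completion.induction_on₂ with
  | hp =>
    refine isClosed_eq ?_ (continuous_fst.inner continuous_snd)
    exact ((ContinuousLinearMap.continuous _).comp continuous_fst).inner
      ((ContinuousLinearMap.continuous _).comp continuous_snd)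
  | ih x y =>
    have e : ∀ z : PreSpace hk h, swRep hk h g (z : Space hk h) = (preRep hk h g z : Space hk h) :=
      fun z => ContinuousLinearMap.completion_apply_coe _ z
    rw [e, e, UniformSpace.Completion.inner_coe, UniformSpace.Completion.inner_coe,
      LinearIsometry.inner_map_map]

/-! ### The leading component and the Coxeter--Laplace operator -/

/-- The unit vector `p t₂₁ + q t₁₂` with `q = √(1 - p²)`, for `p ∈ [-1, 1]`. -/
noncomputable def stationaryVec (p : ℝ) (hp : p ∈ Set.Icc (-1 : ℝ) 1) : UnitVec :=
  ⟨!₂[(p : ℂ), ((Real.sqrt (1 - p ^ 2) : ℝ) : ℂ)], by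
    have h : 0 ≤ 1 - p ^ 2 := by nlinarith [hp.1, hp.2]
    rw [mem_sphere_zero_iff_norm, EuclideanSpace.norm_eq, Fin.sum_univ_two]
    simp [Real.sq_sqrt h]⟩

/-- The Hilbert space of the leading component `Π_1` of the stationary Schur--Weyl representation
with parameters `p`, `q = √(1 - p²)`. -/
abbrev LeadingSpace (p : ℝ) (hp : p ∈ Set.Icc (-1 : ℝ) 1) : Type :=
  Space Nat.one_pos (fun _ => stationaryVec p hp)

/-- The leading component `Π_1`: all the vectors `h_n` coincide with `p t₂₁ + q t₁₂`. -/
noncomputable def leadingRep (p : ℝ) (hp : p ∈ Set.Icc (-1 : ℝ) 1) :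
    symInf →* (LeadingSpace p hp →L[ℂ] LeadingSpace p hp) :=
  swRep Nat.one_pos (fun _ => stationaryVec p hp)

/-- The extension of `Π_1` to the group algebra of `𝔖_ℕ`. -/
noncomputable def leadingAlg (p : ℝ) (hp : p ∈ Set.Icc (-1 : ℝ) 1) :
    MonoidAlgebra ℂ symInf →ₐ[ℂ] (LeadingSpace p hp →L[ℂ] LeadingSpace p hp) :=
  MonoidAlgebra.lift ℂ _ symInf (leadingRep p hp)

/-- The transposition `(i, j)` as an element of `𝔖_ℕ`. -/
def transp (i j : ℕ) : symInf :=
  ⟨Equiv.swap i j, max i j + 1, fun _ hx =>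
    Equiv.swap_apply_of_ne_of_ne (by omega) (by omega)⟩

/-- The periodic Coxeter Laplacian `L_N = N e - (s_1 + ⋯ + s_N)` in the group algebra, where
`s_j = (j, j + 1)` with `N + 1 ≡ 1`. -/
noncomputable def coxeterLaplacian (N : ℕ) : MonoidAlgebra ℂ symInf :=
  (N : ℂ) • (1 : MonoidAlgebra ℂ symInf)
    - ∑ j ∈ Finset.range N, MonoidAlgebra.of ℂ symInf (transp j ((j + 1) % N))

end SchurWeyl

/-!
A vector of the `m`-th space of the chain is carried to the next spaces by adding pairs of letters;
every pair is put into the rows `21` with amplitude `p` and `12` with amplitude `q`, independently of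
the others, and the rows differ in length by one before each pair. Far transpositions `s_j` therefore
act on the added letters only, and their matrix elements between two such vectors are multiples of
the inner product by a constant that depends on the parity of `j` alone:

* if `j`, `j + 1` form one pair, the axial distance is `±2` and the constant is
  `p²/2 - q²/2 + √3 p q = p² - 1/2 + √3 p q` (`inner_emb_youngOp`);
* if `j`, `j + 1` link two pairs, the axial distance is `-1` for `21|21`, `3` for `12|12` and `1` for
  `21|12` and `12|21`. For `12|12` the off-diagonal term of `s_j` leads to `11|22`, which is not a
  sequence of pairs `21` and `12` and hence orthogonal to the subspace; the constant is
  `-p⁴ + q⁴/3 + 2 p² q² = 1/3 + 4/3 p² - 8/3 p⁴` (`inner_emb_emb_youngOp`).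

So `⟨y, s_j x⟩ + ⟨y, s_{j+1} x⟩` is eventually the same multiple `c ⟨y, x⟩` for `x`, `y` in the
algebraic inductive limit, and converges to `c ⟨y, x⟩` for all `x`, `y` because the operators are
unitary (`tendsto_inner_leadingRep_add_succ`). The averages of `⟨y, s_j x⟩` then converge to
`c / 2 ⟨y, x⟩`, the one transposition that closes the period being negligible
(`tendsto_inner_average`), and `1 - c / 2` is the constant `φ(p)`.
-/

namespace SchurWeyl

/-! ### Averages of sequences -/

/-- A bounded sequence that is asymptotically periodic with period two, in the sense that
`u j + u (j + 1) → 2 c`, has the Cesàro limit `c`. -/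
theorem tendsto_average_of_add_succ {u : ℕ → ℂ} {c : ℂ} {C : ℝ} (hC : ∀ j, ‖u j‖ ≤ C)
    (h : Filter.Tendsto (fun j => u j + u (j + 1)) Filter.atTop (nhds (2 * c))) :
    Filter.Tendsto (fun N : ℕ => (1 / (N : ℂ)) * ∑ j ∈ Finset.range N, u j) Filter.atTop
      (nhds c) := by
  have h1 := (h.cesaro_smul).const_mul (1 / 2 : ℂ)
  have h2 : Filter.Tendsto (fun N : ℕ => (1 / (N : ℂ)) * ((u 0 - u N) / 2)) Filter.atTop
      (nhds 0) := by
    refine squeeze_zero_norm (a := fun N : ℕ => 1 / (N : ℝ) * C) (fun N => ?_) ?_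
    · rw [norm_mul, norm_div, norm_one, Complex.norm_natCast]
      gcongr
      rw [norm_div, Complex.norm_ofNat]
      linarith [norm_sub_le (u 0) (u N), hC 0, hC N]
    · simpa using tendsto_one_div_atTop_nhds_zero_nat.mul_const C
  have h3 := h1.add h2
  rw [add_zero, show (1 / 2 : ℂ) * (2 * c) = c by ring] at h3
  refine h3.congr fun N => ?_
  have hs : ∑ j ∈ Finset.range N, u (j + 1) = ∑ j ∈ Finset.range N, u j + u N - u 0 := by
    rw [← Finset.sum_range_succ, Finset.sum_range_succ']; ring
  rw [Finset.sum_add_distrib, hs, Complex.real_smul]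
  push_cast
  ring

/-! ### Young's orthogonal form on the letters added by the embeddings -/

section Added

variable {a b : ℕ}

theorem height_addTab (hab : b < a) (r : Fin 2) (t : Tableau a b) :
    height (addTab hab r t).row (a + b) = (a : ℤ) - b := by
  have e : ∀ i, rowLen (addTab hab r t).row i (a + b) = rowLen t.row i (a + b) := fun i =>
    rowLen_congr i _ fun m hm => by simp [addTab, addWord, hm]
  rw [height, e, e, t.isTableau.len_zero, t.isTableau.len_one]

theorem addTab_row_left (hab : b < a) (r : Fin 2) (t : Tableau a b) :
    (addTab hab r t).row (a + b) = r := by simp [addTab, addWord]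

theorem addTab_row_right (hab : b < a) (r : Fin 2) (t : Tableau a b) :
    (addTab hab r t).row (a + b + 1) = 1 - r := by simp [addTab, addWord]

theorem axialDist_addTab (hab : b < a) (r : Fin 2) (t : Tableau a b) :
    axialDist (addTab hab r t).row (a + b)
      = if r = 1 then (a : ℤ) - b + 1 else -((a : ℤ) - b + 1) := by
  have h1 := addTab_row_left hab r t
  have h2 := addTab_row_right hab r t
  rcases fin2 r with rfl | rfl
  · rw [axialDist_zero_one h1 h2, height_addTab]; simp
  · rw [axialDist_one_zero h1 h2, height_addTab]; simp

theorem swapTab_addTab (hab : b < a) (r : Fin 2) (t : Tableau a b) :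
    swapTab (a + b) (addTab hab r t) = addTab hab (1 - r) t := by
  have e : swapWord (addTab hab r t).row (a + b) = (addTab hab (1 - r) t).row := by
    funext m
    by_cases h1 : m = a + b
    · rw [h1, swapWord_apply_left, addTab_row_right, addTab_row_left]
    by_cases h2 : m = a + b + 1
    · rw [h2, swapWord_apply_right, addTab_row_right, addTab_row_left, sub_sub_cancel]
    rw [swapWord_apply_of_ne _ h1 h2]
    simp [addTab, addWord, h1, h2]
  have h : IsTableau (a + 1) (b + 1) (swapWord (addTab hab r t).row (a + b)) :=
    e ▸ (addTab hab (1 - r) t).isTableau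
  rw [swapTab_of h]
  exact Tableau.ext e

/-- The matrix elements of a Coxeter transposition in the basis of tableaux. -/
theorem inner_single_youngOp {j : ℕ} (hj : j + 1 < a + b) (s t : Tableau a b) :
    inner ℂ (EuclideanSpace.single s (1 : ℂ)) (youngOp a b j (EuclideanSpace.single t 1))
      = diagCoeff t.row j * (if s = t then 1 else 0)
        + offCoeff t.row j * (if s = swapTab j t then 1 else 0) := by
  rw [youngOp_single hj]
  simp only [inner_add_right, inner_smul_right, EuclideanSpace.inner_single_left,
    PiLp.single_apply, map_one, one_mul]

/-- The transposition of the two letters of one added pair, next to a shape with `a - b = 1`: the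
axial distances are `±2`. -/
theorem inner_addTab_youngOp (hlt : b < a) (hab : a = b + 1) (r r' : Fin 2) (t t' : Tableau a b) :
    inner ℂ (EuclideanSpace.single (addTab hlt r t) (1 : ℂ))
        (youngOp (a + 1) (b + 1) (a + b) (EuclideanSpace.single (addTab hlt r' t') 1))
      = (if r = r' then if r = 1 then 1 / 2 else -1 / 2 else ((√3 / 2 : ℝ) : ℂ))
        * if t = t' then 1 else 0 := by
  have hd : ∀ r, axialDist (addTab hlt r t').row (a + b) = if r = 1 then 2 else -2 := fun r => by
    rw [axialDist_addTab, hab]; push_cast; split_ifs <;> ring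
  have hoff : ∀ r, offCoeff (addTab hlt r t').row (a + b) = ((√3 / 2 : ℝ) : ℂ) := fun r => by
    have h3 : √(1 - ((2 : ℝ)⁻¹) ^ 2) = √3 / 2 := by
      rw [show (1 - ((2 : ℝ)⁻¹) ^ 2) = 3 / 2 ^ 2 by norm_num, Real.sqrt_div (by norm_num),
        Real.sqrt_sq (by norm_num)]
    rw [offCoeff, hd, ← h3]
    split_ifs <;> simp [inv_neg]
  have hdiag : ∀ r, diagCoeff (addTab hlt r t').row (a + b)
      = if r = 1 then 1 / 2 else -1 / 2 := fun r => by
    rw [diagCoeff_eq (hd r)]; split_ifs <;> norm_num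
  have hinj : ∀ r r', addTab hlt r t = addTab hlt r' t' ↔ t = t' ∧ r = r' :=
    fun r r' => ⟨addTab_inj hlt, by rintro ⟨rfl, rfl⟩; rfl⟩
  rw [inner_single_youngOp (by omega), swapTab_addTab]
  simp only [hoff, hdiag, hinj]
  by_cases ht : t = t' <;> rcases fin2 r with rfl | rfl <;> rcases fin2 r' with rfl | rfl <;>
    simp [ht]

/-- The transposition of the last letter of one added pair and the first letter of the next one,
next to a shape with `a - b = 1`. It is diagonal between the doubly extended tableaux: if the two
letters differ, their interchange yields a word whose first added pair lies in one row. -/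
theorem inner_addTab_addTab_youngOp (hlt : b < a) (hlt' : b + 1 < a + 1) (hab : a = b + 1)
    (r s r' s' : Fin 2) (t t' : Tableau a b) :
    inner ℂ (EuclideanSpace.single (addTab hlt' s (addTab hlt r t)) (1 : ℂ))
        (youngOp (a + 1 + 1) (b + 1 + 1) (a + b + 1)
          (EuclideanSpace.single (addTab hlt' s' (addTab hlt r' t')) 1))
      = (if r = r' ∧ s = s' then
          if r = s then if r = 1 then -1 else 1 / 3 else 1 else 0)
        * if t = t' then 1 else 0 := by
  have row0 : ∀ r s (t : Tableau a b), (addTab hlt' s (addTab hlt r t)).row (a + b) = r :=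
    fun r s t => by simp [addTab, addWord, show a + b < a + 1 + (b + 1) by omega]
  have row1 : ∀ r s (t : Tableau a b), (addTab hlt' s (addTab hlt r t)).row (a + b + 1) = 1 - r :=
    fun r s t => by simp [addTab, addWord, show a + b + 1 < a + 1 + (b + 1) by omega]
  have row2 : ∀ r s (t : Tableau a b), (addTab hlt' s (addTab hlt r t)).row (a + b + 1 + 1) = s :=
    fun r s t => by simp [addTab, addWord, show a + b + 1 + 1 = a + 1 + (b + 1) by omega]
  -- No two distinct doubly extended tableaux are related by the interchange.
  have hoff : offCoeff (addTab hlt' s' (addTab hlt r' t')).row (a + b + 1) * (if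
      addTab hlt' s (addTab hlt r t) = swapTab (a + b + 1) (addTab hlt' s' (addTab hlt r' t'))
      then 1 else 0) = 0 := by
    by_cases hc : offCoeff (addTab hlt' s' (addTab hlt r' t')).row (a + b + 1) = 0
    · rw [hc, zero_mul]
    rw [if_neg, mul_zero]
    intro he
    apply hc
    have hsw := (addTab hlt' s' (addTab hlt r' t')).isTableau.swap (by omega) hc
    rw [swapTab_of hsw] at he
    have e0 := congrArg (fun u => u.row (a + b)) he
    have e1 := congrArg (fun u => u.row (a + b + 1)) he
    -- The first pair of the interchanged word has the letters `r'`, `s'`; they differ, so `s' = 1 - r'`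
    -- and the two interchanged letters were equal, which contradicts `hc`.
    simp only [row0, row1, swapWord_apply_left, row2,
      swapWord_apply_of_ne _ (show a + b ≠ a + b + 1 by omega)
        (show a + b ≠ a + b + 1 + 1 by omega)] at e0 e1
    exact offCoeff_same (by rw [row1, row2, ← e1, e0])
  have hh : height (addTab hlt' s' (addTab hlt r' t')).row (a + b) = 1 := by
    have e : ∀ i, rowLen (addTab hlt' s' (addTab hlt r' t')).row i (a + b)
        = rowLen (addTab hlt r' t').row i (a + b) := fun i =>
      rowLen_congr i _ fun m hm => by simp [addTab, addWord, show m < a + 1 + (b + 1) by omega]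
    have := height_addTab hlt r' t'
    simp only [height, e] at this ⊢
    omega
  have hdiag : diagCoeff (addTab hlt' s' (addTab hlt r' t')).row (a + b + 1)
      = if r' = s' then if r' = 1 then -1 else 1 / 3 else 1 := by
    have w0 := row0 r' s' t'
    have w1 := row1 r' s' t'
    have w2 := row2 r' s' t'
    rcases fin2 r' with rfl | rfl <;> rcases fin2 s' with rfl | rfl
    · rw [diagCoeff_eq (axialDist_one_zero (by simpa using w1) w2), height_succ_zero w0, hh]
      norm_num
    · rw [diagCoeff_same (by rw [w1, w2]; rfl)]; simp
    · rw [diagCoeff_same (by rw [w1, w2]; rfl)]; simp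
    · rw [diagCoeff_eq (axialDist_zero_one (by simpa using w1) w2), height_succ_one w0, hh]
      norm_num
  have hinj : addTab hlt' s (addTab hlt r t) = addTab hlt' s' (addTab hlt r' t')
      ↔ (r = r' ∧ s = s') ∧ t = t' := by
    refine ⟨fun h => ?_, by rintro ⟨⟨rfl, rfl⟩, rfl⟩; rfl⟩
    obtain ⟨h1, h2⟩ := addTab_inj hlt' h
    obtain ⟨h3, h4⟩ := addTab_inj hlt h1
    exact ⟨⟨h4, h2⟩, h3⟩
  rw [inner_single_youngOp (by omega), hoff, add_zero, hdiag]
  simp only [hinj]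
  by_cases h1 : r = r' ∧ s = s'
  · obtain ⟨rfl, rfl⟩ := h1
    simp
  · simp [h1]

/-- If `⟨S t, T t'⟩ = c ⟨t, t'⟩` for all tableaux `t`, `t'`, then the same holds for all vectors. -/
theorem inner_map_map_eq_mul_inner {F : Type*} [NormedAddCommGroup F] [InnerProductSpace ℂ F]
    (S T : Specht a b →ₗ[ℂ] F) (c : ℂ)
    (h : ∀ t t', inner ℂ (S (EuclideanSpace.single t 1)) (T (EuclideanSpace.single t' 1))
      = c * if t = t' then 1 else 0) (x y : Specht a b) :
    inner ℂ (S x) (T y) = c * inner ℂ x y := by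
  have hx : ∀ x : Specht a b, x = ∑ t, x t • EuclideanSpace.single t (1 : ℂ) := fun x =>
    (by simpa using ((EuclideanSpace.basisFun (Tableau a b) ℂ).sum_repr x).symm)
  conv_lhs => rw [hx x, hx y]
  simp only [map_sum, map_smul, sum_inner, inner_sum, inner_smul_left, inner_smul_right, h,
    PiLp.inner_apply, RCLike.inner_apply]
  rw [Finset.mul_sum]
  refine Finset.sum_congr rfl fun t _ => ?_
  simp only [mul_ite, mul_one, mul_zero, Finset.sum_ite_eq', Finset.mem_univ, if_true]
  ring

end Added

/-! ### Matrix elements of the Coxeter transpositions -/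

section MatrixElements

variable {a b : ℕ} {p : ℝ} (hp : p ∈ Set.Icc (-1 : ℝ) 1)

theorem stationaryVec_zero : (stationaryVec p hp).1 0 = (p : ℂ) := rfl

theorem stationaryVec_one : (stationaryVec p hp).1 1 = ((√(1 - p ^ 2) : ℝ) : ℂ) := rfl

theorem sqrt_one_sub_sq {p : ℝ} (hp : p ∈ Set.Icc (-1 : ℝ) 1) :
    ((√(1 - p ^ 2) : ℝ) : ℂ) ^ 2 = 1 - (p : ℂ) ^ 2 := by
  have h : 0 ≤ 1 - p ^ 2 := by nlinarith [hp.1, hp.2]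
  rw [← Complex.ofReal_pow, Real.sq_sqrt h]
  push_cast
  rfl

/-- The expectation of the transposition inside a pair: `p²/2 - q²/2 + √3 p q`. -/
theorem inner_emb_youngOp (hab : b < a) (h : a = b + 1) (x y : Specht a b) :
    inner ℂ (emb hab (stationaryVec p hp) x)
        (youngOp (a + 1) (b + 1) (a + b) (emb hab (stationaryVec p hp) y))
      = ((p ^ 2 - 1 / 2 + √3 * p * √(1 - p ^ 2) : ℝ) : ℂ) * inner ℂ x y := by
  refine inner_map_map_eq_mul_inner (emb hab (stationaryVec p hp)).toLinearMap
    ((youngOp (a + 1) (b + 1) (a + b)).toLinearMap ∘ₗ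
      (emb hab (stationaryVec p hp)).toLinearMap) _ (fun t t' => ?_) x y
  simp only [LinearMap.comp_apply, LinearIsometry.coe_toLinearMap, emb_single, map_add, map_smul,
    inner_add_left, inner_add_right, inner_smul_left, inner_smul_right, inner_addTab_youngOp hab h,
    stationaryVec_zero, stationaryVec_one, Complex.conj_ofReal, if_true, if_neg zero_ne_one,
    if_neg one_ne_zero]
  push_cast
  linear_combination (-1 / 2 * if t = t' then 1 else 0) * sqrt_one_sub_sq hp

/-- The expectation of the transposition that links two pairs: `-p⁴ + 2 p² q² + q⁴/3`. -/
theorem inner_emb_emb_youngOp (hab : b < a) (hab' : b + 1 < a + 1) (h : a = b + 1)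
    (x y : Specht a b) :
    inner ℂ (emb hab' (stationaryVec p hp) (emb hab (stationaryVec p hp) x))
        (youngOp (a + 1 + 1) (b + 1 + 1) (a + b + 1)
          (emb hab' (stationaryVec p hp) (emb hab (stationaryVec p hp) y)))
      = ((1 / 3 + 4 / 3 * p ^ 2 - 8 / 3 * p ^ 4 : ℝ) : ℂ) * inner ℂ x y := by
  refine inner_map_map_eq_mul_inner ((emb hab' (stationaryVec p hp)).toLinearMap ∘ₗ
      (emb hab (stationaryVec p hp)).toLinearMap)
    ((youngOp (a + 1 + 1) (b + 1 + 1) (a + b + 1)).toLinearMap ∘ₗ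
      (emb hab' (stationaryVec p hp)).toLinearMap ∘ₗ
      (emb hab (stationaryVec p hp)).toLinearMap) _ (fun t t' => ?_) x y
  simp only [LinearMap.comp_apply, LinearIsometry.coe_toLinearMap, emb_single, map_add, map_smul,
    inner_add_left, inner_add_right, inner_smul_left, inner_smul_right,
    inner_addTab_addTab_youngOp hab hab' h, stationaryVec_zero, stationaryVec_one, Complex.conj_ofReal,
    if_true, and_true, true_and, and_self, zero_ne_one, one_ne_zero]
  simp only [if_false]
  push_cast
  linear_combination (((if t = t' then 1 else 0 : ℂ) * ((1 / 3) * ((√(1 - p ^ 2) : ℝ) : ℂ) ^ 2 +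
    5 / 3 * (p : ℂ) ^ 2 + 1 / 3))) * sqrt_one_sub_sq hp

end MatrixElements

/-! ### Weak limits of averages of uniformly bounded operators -/

section WeakLimits

variable {H : Type*} [NormedAddCommGroup H] [InnerProductSpace ℂ H]

/-- Weak convergence of uniformly bounded operators to a scalar operator may be tested on a dense
set of vectors. -/
theorem tendsto_inner_of_dense {D : Set H} (hD : Dense D) {S : ℕ → H →L[ℂ] H} {C : NNReal}
    (hC : ∀ j x, ‖S j x‖ ≤ C * ‖x‖) {c : ℂ}
    (h : ∀ x ∈ D, ∀ y ∈ D, Filter.Tendsto (fun j => inner ℂ y (S j x)) Filter.atTop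
      (nhds (c * inner ℂ y x))) (x y : H) :
    Filter.Tendsto (fun j => inner ℂ y (S j x)) Filter.atTop (nhds (c * inner ℂ y x)) := by
  have hle : ∀ j (x y : H), ‖inner ℂ y (S j x)‖ ≤ C * ‖x‖ * ‖y‖ := fun j x y =>
    (norm_inner_le_norm _ _).trans (by rw [mul_comm]; gcongr; exact hC j x)
  have hx : ∀ y ∈ D, ∀ x : H, Filter.Tendsto (fun j => inner ℂ y (S j x)) Filter.atTop
      (nhds (c * inner ℂ y x)) := by
    intro y hy x
    refine (IsClosed.closure_subset_iff (Equicontinuous.isClosed_setOfPred_tendsto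
      (F := fun j (x : H) => inner ℂ y (S j x)) (f := fun x => c * inner ℂ y x) ?_
      (by fun_prop))).2 (fun x hx => h x hx y hy) (hD x)
    refine (LipschitzWith.uniformEquicontinuous _ (C * ‖y‖₊) fun j => ?_).equicontinuous
    refine LipschitzWith.of_dist_le_mul fun x x' => ?_
    rw [dist_eq_norm, dist_eq_norm, ← inner_sub_right, ← map_sub]
    refine (hle j (x - x') y).trans_eq ?_
    push_cast
    ring
  refine (IsClosed.closure_subset_iff (Equicontinuous.isClosed_setOfPred_tendsto
    (F := fun j (y : H) => inner ℂ y (S j x)) (f := fun y => c * inner ℂ y x) ?_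
    (by fun_prop))).2 (fun y hy => hx y hy x) (hD y)
  refine (LipschitzWith.uniformEquicontinuous _ (C * ‖x‖₊) fun j => ?_).equicontinuous
  refine LipschitzWith.of_dist_le_mul fun y y' => ?_
  rw [dist_eq_norm, dist_eq_norm, ← inner_sub_left]
  exact hle j x (y - y')

/-- If the sums `U j + U (j + 1)` of consecutive contractions converge weakly to the scalar `c`,
then the averages of `V N 0, …, V N (N - 1)` converge weakly to `c / 2` whenever `V N j = U j` for all
`j` but the last one. The statement is about `1` minus these averages. -/
theorem tendsto_inner_average {U : ℕ → H →L[ℂ] H} (hU : ∀ j x, ‖U j x‖ ≤ ‖x‖)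
    {V : ℕ → ℕ → H →L[ℂ] H} (hV : ∀ N j x, ‖V N j x‖ ≤ ‖x‖)
    (hUV : ∀ N j, j + 1 < N → V N j = U j) {c : ℂ} {x y : H}
    (h : Filter.Tendsto (fun j => inner ℂ y (U j x) + inner ℂ y (U (j + 1) x)) Filter.atTop
      (nhds (c * inner ℂ y x))) :
    Filter.Tendsto (fun N : ℕ => inner ℂ y
        (((1 / (N : ℂ)) • ((N : ℂ) • (1 : H →L[ℂ] H) - ∑ j ∈ Finset.range N, V N j)) x))
      Filter.atTop (nhds ((1 - c / 2) * inner ℂ y x)) := by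
  have hU' : ∀ j, ‖inner ℂ y (U j x)‖ ≤ ‖y‖ * ‖x‖ := fun j =>
    (norm_inner_le_norm _ _).trans (by gcongr; exact hU j x)
  have hV' : ∀ N j, ‖inner ℂ y (V N j x)‖ ≤ ‖y‖ * ‖x‖ := fun N j =>
    (norm_inner_le_norm _ _).trans (by gcongr; exact hV N j x)
  have h1 := tendsto_average_of_add_succ (c := c / 2 * inner ℂ y x) hU'
    (by rwa [← mul_assoc, mul_div_cancel₀ c two_ne_zero])
  have h2 : Filter.Tendsto (fun N : ℕ => (1 / (N : ℂ)) * (∑ j ∈ Finset.range N,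
      inner ℂ y (V N j x) - ∑ j ∈ Finset.range N, inner ℂ y (U j x))) Filter.atTop (nhds 0) := by
    refine squeeze_zero_norm (a := fun N : ℕ => 1 / (N : ℝ) * (2 * (‖y‖ * ‖x‖))) (fun N => ?_) ?_
    · rw [norm_mul, norm_div, norm_one, Complex.norm_natCast]
      gcongr
      rcases N with _ | N
      · simp; positivity
      -- The two sums differ in their last term only.
      rw [Finset.sum_range_succ, Finset.sum_range_succ,
        Finset.sum_congr rfl fun j hj => by
          rw [hUV (N + 1) j (Nat.succ_lt_succ (Finset.mem_range.mp hj))],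
        add_sub_add_left_eq_sub]
      refine (norm_sub_le _ _).trans ?_
      linarith [hV' (N + 1) N, hU' N]
    · simpa using tendsto_one_div_atTop_nhds_zero_nat.mul_const (2 * (‖y‖ * ‖x‖))
  have h3 := (tendsto_const_nhds (x := inner ℂ y x)).sub (h1.add h2)
  rw [show inner ℂ y x - (c / 2 * inner ℂ y x + 0) = (1 - c / 2) * inner ℂ y x by ring] at h3
  refine h3.congr' ?_
  filter_upwards [Filter.eventually_ne_atTop 0] with N hN
  have hN' : (N : ℂ) ≠ 0 := Nat.cast_ne_zero.mpr hN
  rw [smul_apply, sub_apply, smul_apply, sum_apply, one_apply_eq_self, inner_smul_right,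
    inner_sub_right, inner_smul_right, inner_sum]
  field_simp
  ring

end WeakLimits

/-- The image of the normalised Laplacian under the extension of a representation to the group
algebra. -/
theorem lift_coxeterLaplacian {A : Type*} [Ring A] [Algebra ℂ A] (ρ : symInf →* A) (N : ℕ) :
    MonoidAlgebra.lift ℂ A symInf ρ ((1 / (N : ℂ)) • coxeterLaplacian N)
      = (1 / (N : ℂ)) • ((N : ℂ) • (1 : A)
        - ∑ j ∈ Finset.range N, ρ (transp j ((j + 1) % N))) := by
  rw [map_smul, coxeterLaplacian, map_sub, map_smul, map_one, map_sum]
  simp only [MonoidAlgebra.lift_of]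

/-! ### The leading component -/

section Leading

variable {p : ℝ} (hp : p ∈ Set.Icc (-1 : ℝ) 1)

/-- The vector of `Π_1` given by an element of the `n`-th space of the chain. -/
noncomputable def ofLevel (n : ℕ) (f : Specht (1 + n) n) : LeadingSpace p hp :=
  ((AlgLimit.of (step Nat.one_pos fun _ => stationaryVec p hp) n f :
    PreSpace Nat.one_pos fun _ => stationaryVec p hp) : LeadingSpace p hp)

theorem inner_ofLevel (n : ℕ) (f g : Specht (1 + n) n) :
    inner ℂ (ofLevel hp n f) (ofLevel hp n g) = inner ℂ f g := by
  rw [ofLevel, ofLevel, UniformSpace.Completion.inner_coe, AlgLimit.inner_of]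

theorem ofLevel_transition {n m : ℕ} (h : n ≤ m) (f : Specht (1 + n) n) :
    ofLevel hp m (transition (E := fun n => Specht (1 + n) n)
      (step Nat.one_pos fun _ => stationaryVec p hp) n m h f) = ofLevel hp n f := by
  rw [ofLevel, AlgLimit.of_transition]
  rfl

theorem ofLevel_step (n : ℕ) (f : Specht (1 + n) n) :
    ofLevel hp (n + 1) (step Nat.one_pos (fun _ => stationaryVec p hp) n f) = ofLevel hp n f := by
  rw [← ofLevel_transition hp n.le_succ f, transition_succ _ n n le_rfl, transition_self]
  rfl

theorem leadingRep_transp_ofLevel {j n : ℕ} (hj : j + 1 < 1 + n + n) (f : Specht (1 + n) n) :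
    leadingRep p hp (transp j (j + 1)) (ofLevel hp n f)
      = ofLevel hp n (youngOp (1 + n) n j f) := by
  rw [← spechtRep_cox hj]
  exact swRep_of Nat.one_pos _ (transp j (j + 1)) n (cox_mem hj) f

/-- For odd `j = 2 m + 1` the letters `j`, `j + 1` form the pair added to the `m`-th shape. -/
theorem inner_leadingRep_odd (m : ℕ) (f g : Specht (1 + m) m) :
    inner ℂ (ofLevel hp m f)
        (leadingRep p hp (transp (1 + m + m) (1 + m + m + 1)) (ofLevel hp m g))
      = ((p ^ 2 - 1 / 2 + √3 * p * √(1 - p ^ 2) : ℝ) : ℂ)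
        * inner ℂ (ofLevel hp m f) (ofLevel hp m g) := by
  rw [inner_ofLevel, ← inner_emb_youngOp hp (by omega) (by omega), ← ofLevel_step hp m f,
    ← ofLevel_step hp m g, leadingRep_transp_ofLevel hp (by omega), inner_ofLevel]
  rfl

/-- For even `j = 2 m + 2` the letters `j`, `j + 1` belong to the pairs added to the `m`-th shape and
to the next one. -/
theorem inner_leadingRep_even (m : ℕ) (f g : Specht (1 + m) m) :
    inner ℂ (ofLevel hp m f)
        (leadingRep p hp (transp (1 + m + m + 1) (1 + m + m + 1 + 1)) (ofLevel hp m g))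
      = ((1 / 3 + 4 / 3 * p ^ 2 - 8 / 3 * p ^ 4 : ℝ) : ℂ)
        * inner ℂ (ofLevel hp m f) (ofLevel hp m g) := by
  rw [inner_ofLevel, ← inner_emb_emb_youngOp hp (by omega) (by omega) (by omega),
    ← ofLevel_step hp m f, ← ofLevel_step hp m g, ← ofLevel_step hp (m + 1),
    ← ofLevel_step hp (m + 1), leadingRep_transp_ofLevel hp (by omega), inner_ofLevel]
  rfl

theorem norm_leadingRep (g : symInf) (x : LeadingSpace p hp) :
    ‖leadingRep p hp g x‖ = ‖x‖ := by
  rw [@norm_eq_sqrt_re_inner ℂ, @norm_eq_sqrt_re_inner ℂ]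
  exact congrArg (fun z : ℂ => √(RCLike.re z)) (swRep_inner Nat.one_pos _ g x x)

theorem exists_ofLevel₂ (x y : PreSpace Nat.one_pos fun _ => stationaryVec p hp) :
    ∃ n f g, (x : LeadingSpace p hp) = ofLevel hp n f ∧ (y : LeadingSpace p hp) = ofLevel hp n g := by
  obtain ⟨n, -, f, rfl⟩ := AlgLimit.exists_of _ 0 x
  obtain ⟨m, hm, g, rfl⟩ := AlgLimit.exists_of _ n y
  exact ⟨m, _, g, (ofLevel_transition hp hm f).symm, rfl⟩

/-- The vectors of the algebraic inductive limit are dense, and between two of them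
`⟨y, s_j x⟩ + ⟨y, s_{j+1} x⟩` does not depend on `j` when `j` is large. -/
theorem tendsto_inner_leadingRep_add_succ (x y : LeadingSpace p hp) :
    Filter.Tendsto (fun j => inner ℂ y ((leadingRep p hp (transp j (j + 1))
        + leadingRep p hp (transp (j + 1) (j + 1 + 1))) x)) Filter.atTop
      (nhds (((p ^ 2 - 1 / 2 + √3 * p * √(1 - p ^ 2)
        + (1 / 3 + 4 / 3 * p ^ 2 - 8 / 3 * p ^ 4) : ℝ) : ℂ) * inner ℂ y x)) := by
  refine tendsto_inner_of_dense (C := 2)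
    (UniformSpace.Completion.denseRange_coe (α := PreSpace Nat.one_pos fun _ => stationaryVec p hp))
    (fun j x => ?_) ?_ x y
  · rw [add_apply]
    refine (norm_add_le _ _).trans_eq ?_
    rw [norm_leadingRep, norm_leadingRep, NNReal.coe_ofNat, two_mul]
  rintro _ ⟨x, rfl⟩ _ ⟨y, rfl⟩
  obtain ⟨n, f, g, hx, hy⟩ := exists_ofLevel₂ hp x y
  rw [hx, hy]
  refine tendsto_const_nhds.congr' ?_
  filter_upwards [Filter.eventually_ge_atTop (1 + n + n)] with j hj
  obtain ⟨m, hm, hjm⟩ : ∃ m, n ≤ m ∧ (j = 1 + m + m ∨ j = 1 + m + m + 1) :=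
    ⟨(j - 1) / 2, by omega, by omega⟩
  rw [add_apply, inner_add_right, ← ofLevel_transition hp hm f, ← ofLevel_transition hp hm g]
  rcases hjm with rfl | rfl
  · rw [inner_leadingRep_odd, inner_leadingRep_even, ← add_mul, ← Complex.ofReal_add]
  · have e : 1 + m + m + 1 + 1 = 1 + (m + 1) + (m + 1) := by ring
    rw [inner_leadingRep_even, e, ← ofLevel_step hp m, ← ofLevel_step hp m, inner_leadingRep_odd,
      ← add_mul, ← Complex.ofReal_add, add_comm]

end Leading

end SchurWeyl

theorem mainTheorem3 (p : ℝ) (hp : p ∈ Set.Icc (-1 : ℝ) 1) :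
    Filter.Tendsto
      (fun N : ℕ => ContinuousLinearMapWOT.ofCLM
        (SchurWeyl.leadingAlg p hp ((1 / (N : ℂ)) • SchurWeyl.coxeterLaplacian N)))
      Filter.atTop
      (nhds (ContinuousLinearMapWOT.ofCLM
        (((13 / 12 + 8 / 6 * p ^ 4 - 7 / 6 * p ^ 2
            - Real.sqrt 3 / 2 * p * Real.sqrt (1 - p ^ 2) : ℝ) : ℂ) •
          (1 : SchurWeyl.LeadingSpace p hp →L[ℂ] SchurWeyl.LeadingSpace p hp)))) := by
  rw [ContinuousLinearMapWOT.tendsto_iff_forall_inner_apply_tendsto]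
  intro x y
  have h := SchurWeyl.tendsto_inner_leadingRep_add_succ hp x y
  simp only [add_apply, inner_add_right] at h
  have h1 := SchurWeyl.tendsto_inner_average
    (U := fun j => SchurWeyl.leadingRep p hp (SchurWeyl.transp j (j + 1)))
    (V := fun N j => SchurWeyl.leadingRep p hp (SchurWeyl.transp j ((j + 1) % N)))
    (fun j x => (SchurWeyl.norm_leadingRep hp _ x).le)
    (fun N j x => (SchurWeyl.norm_leadingRep hp _ x).le)
    (fun N j hj => by rw [Nat.mod_eq_of_lt hj])
    h
  simp only [ContinuousLinearMapWOT.ofCLM_apply, SchurWeyl.leadingAlg,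
    SchurWeyl.lift_coxeterLaplacian, smul_apply, one_apply_eq_self, inner_smul_right] at h1 ⊢
  convert h1 using 3
  push_cast
  ring
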